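/- Let ${\cal S},{\cal X},{\cal Y},{\cal Z}$ be finite alphabets, $p(s)$ a probability distribution on ${\cal S}$, and $p(y,z|x,s)$ a discrete memoryless channel with input $x\in{\cal X}$ and state $s\in{\cal S}$, whose output $y\in{\cal Y}$ is received by Bob and $z\in{\cal Z}$ by Eve. The state sequence $S^n$ is i.i.d. according to $p(s)$ and is known non-causally to the encoder, which sends $X^n$ according to a (possibly stochastic) encoding law $p(x^n|s^n)$; then $p(y^n,z^n|x^n,s^n)=\prod_{i=1}^n p(y_i,z_i|x_i,s_i)$. A pair $(R_a,R_l)$ is called achievable if for every $\epsilon>0$ and all sufficiently large $n$ there is such an encoder with $$\frac1n I(S^n;Y^n)\ge R_a-\epsilon,\qquad \frac1n I(S^n;Z^n)\le R_l+\epsilon .$$ Let ${\cal C}$ be the set of all achievable pairs. Theorem. Let ${\cal R}^5$ be the closure of the union of all pairs $(R_a,R_l)$ for which there is a real number $R_u$ with $$R_a\le I(S;Y,U)+R_u,$$ $$R_l\ge \min\{I(U,S;Z),\,I(S;Z,U)\},$$ $$R_u\le \min\big\{I(U;Y)-\max\{I(U;S),I(U;Z)\},\,H(S|Y,U)\big\},$$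 over all finite alphabets of the auxiliary variable $U$ and all distributions $p(u,x|s)$ satisfying $I(U;Y)\ge I(U;S)$, where $(S,U,X,Y,Z)$ has the joint distribution $p(s)\,p(u,x|s)\,p(y,z|x,s)$. Then ${\cal R}^5\subseteq{\cal C}$. All entropies and mutual informations are in bits. -/

import Mathlib

namespace StateMasking

/-! ### Entropy and mutual information of random variables on a finite sample space

All logarithms are to base two. A random variable is a function `f : Ω → A` on a finite set `Ω`
which carries a probability mass function `P : Ω → ℝ`. -/

section Information

variable {Ω A B : Type*} [Fintype Ω] [Fintype A] [Fintype B]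

open Classical in
/-- The probability that the random variable `f` takes the value `a`. -/
noncomputable def law (P : Ω → ℝ) (f : Ω → A) (a : A) : ℝ :=
  ∑ ω with f ω = a, P ω

/-- The Shannon entropy `H(f)`, in bits. -/
noncomputable def entropy (P : Ω → ℝ) (f : Ω → A) : ℝ :=
  (∑ a, Real.negMulLog (law P f a)) / Real.log 2

/-- The conditional entropy `H(f | g) = H(f, g) - H(g)`, in bits. -/
noncomputable def condEntropy (P : Ω → ℝ) (f : Ω → A) (g : Ω → B) : ℝ :=
  entropy P (fun ω => (f ω, g ω)) - entropy P g

/-- The mutual information `I(f ; g) = H(f) - H(f | g)`, in bits. -/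
noncomputable def mutualInfo (P : Ω → ℝ) (f : Ω → A) (g : Ω → B) : ℝ :=
  entropy P f - condEntropy P f g

end Information

/-! ### The state-dependent channel

`pS s` is the probability of the state `s`, and `W s x (y, z)` is the probability `p(y, z | x, s)`
that Bob receives `y` and Eve receives `z` when the input is `x` and the state is `s`. -/

section Channel

variable {S X Y Z : Type*} [Fintype S] [Fintype X] [Fintype Y] [Fintype Z]

/-- A stochastic encoder of block length `n`, which knows the whole state sequence in advance:
`enc s x` is the probability that the input sequence `x` is sent when the state sequence is `s`. -/
def IsEncoder {n : ℕ} (enc : (Fin n → S) → (Fin n → X) → ℝ) : Prop :=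
  ∀ s, enc s ∈ stdSimplex ℝ (Fin n → X)

/-- The joint probability mass function of `(Sⁿ, Xⁿ, Yⁿ, Zⁿ)`: the states are i.i.d., the input is
chosen by the encoder, and the channel is memoryless. -/
def blockLaw (pS : S → ℝ) (W : S → X → Y × Z → ℝ) {n : ℕ}
    (enc : (Fin n → S) → (Fin n → X) → ℝ) :
    (Fin n → S) × (Fin n → X) × (Fin n → Y) × (Fin n → Z) → ℝ :=
  fun (s, x, y, z) => (∏ i, pS (s i)) * enc s x * ∏ i, W (s i) (x i) (y i, z i)

/-- The amplification rate `I(Sⁿ ; Yⁿ) / n` of an encoder. -/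
noncomputable def amplificationRate (pS : S → ℝ) (W : S → X → Y × Z → ℝ) {n : ℕ}
    (enc : (Fin n → S) → (Fin n → X) → ℝ) : ℝ :=
  mutualInfo (blockLaw pS W enc) (fun (s, _, _, _) => s) (fun (_, _, y, _) => y) / n

/-- The leakage rate `I(Sⁿ ; Zⁿ) / n` of an encoder. -/
noncomputable def leakageRate (pS : S → ℝ) (W : S → X → Y × Z → ℝ) {n : ℕ}
    (enc : (Fin n → S) → (Fin n → X) → ℝ) : ℝ :=
  mutualInfo (blockLaw pS W enc) (fun (s, _, _, _) => s) (fun (_, _, _, z) => z) / n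

/-- The trade-off region `𝒞` of all achievable pairs `(R_a, R_l)`. -/
def achievableRegion (pS : S → ℝ) (W : S → X → Y × Z → ℝ) : Set (ℝ × ℝ) :=
  {R | ∀ ε : ℝ, 0 < ε → ∃ N : ℕ, ∀ n : ℕ, N ≤ n →
    ∃ enc : (Fin n → S) → (Fin n → X) → ℝ, IsEncoder enc ∧
      R.1 - ε ≤ amplificationRate pS W enc ∧ leakageRate pS W enc ≤ R.2 + ε}

/-- The single-letter joint probability mass function `p(s) p(u, x | s) p(y, z | x, s)` of
`(S, U, X, Y, Z)`, where `q s (u, x)` is `p(u, x | s)`. -/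
def singleLaw {U : Type*} (pS : S → ℝ) (W : S → X → Y × Z → ℝ) (q : S → U × X → ℝ) :
    S × U × X × Y × Z → ℝ :=
  fun (s, u, x, y, z) => pS s * q s (u, x) * W s x (y, z)

/-- The pairs `(R_a, R_l)` which a fixed conditional distribution `p(u, x | s)` contributes to
the secure refinement region (before the condition `I(U;Y) ≥ I(U;S)` is imposed). -/
def refinementPairs {U : Type*} [Fintype U] (pS : S → ℝ) (W : S → X → Y × Z → ℝ)
    (q : S → U × X → ℝ) : Set (ℝ × ℝ) :=
  let P := singleLaw pS W q
  let S' : S × U × X × Y × Z → S := fun (s, _, _, _, _) => s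
  let U' : S × U × X × Y × Z → U := fun (_, u, _, _, _) => u
  let Y' : S × U × X × Y × Z → Y := fun (_, _, _, y, _) => y
  let Z' : S × U × X × Y × Z → Z := fun (_, _, _, _, z) => z
  {R | ∃ Ru : ℝ,
    R.1 ≤ mutualInfo P S' (fun ω => (Y' ω, U' ω)) + Ru ∧
    min (mutualInfo P (fun ω => (U' ω, S' ω)) Z') (mutualInfo P S' (fun ω => (Z' ω, U' ω)))
      ≤ R.2 ∧
    Ru ≤ min (mutualInfo P U' Y' - max (mutualInfo P U' S') (mutualInfo P U' Z'))
      (condEntropy P S' (fun ω => (Y' ω, U' ω)))}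

/-- The condition `I(U;Y) ≥ I(U;S)` on a conditional distribution `p(u, x | s)`. -/
def IsDecodable {U : Type*} [Fintype U] (pS : S → ℝ) (W : S → X → Y × Z → ℝ)
    (q : S → U × X → ℝ) : Prop :=
  let P := singleLaw pS W q
  mutualInfo P (fun (_, u, _, _, _) => u) (fun (s, _, _, _, _) => s)
    ≤ mutualInfo P (fun (_, u, _, _, _) => u) (fun (_, _, _, y, _) => y)

/-- The secure refinement region: the closure of the union, over all finite alphabets of the
auxiliary variable `U` (every finite set being in bijection with some `Fin k`) and all
`p(u, x | s)` with `I(U;Y) ≥ I(U;S)`, of the corresponding pairs. -/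
def secureRefinementRegion (pS : S → ℝ) (W : S → X → Y × Z → ℝ) : Set (ℝ × ℝ) :=
  closure {R | ∃ (k : ℕ) (q : S → Fin k × X → ℝ),
    (∀ s, q s ∈ stdSimplex ℝ (Fin k × X)) ∧ IsDecodable pS W q ∧ R ∈ refinementPairs pS W q}

end Channel

end StateMasking

set_option linter.unusedSectionVars false

namespace StateMasking

open Finset Filter Topology

/-!
Achievability by random coding. The encoder hashes the state sequence, and sends a codeword which
is indexed by the hash, by uniform local randomness, and by an index chosen so that the codeword is
jointly typical with the state. Both Bob's uncertainty about the state and Eve's uncertainty about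
the local randomness, given the state, are bounded by the expected lengths of lists.
-/

/-! ### Entropy inequalities in nats -/

section Entropy

variable {Ω A B : Type*} [Fintype Ω]

/-! Write $i=I(U;S)$ and $R=\max\{I(U;S),I(U;Z)\}-I(U;S)$, and work in nats up to the last
reduction. A random hash maps state sequences to about $e^{n\max(R_u,0)}$ values. For each hash
value, each of about $e^{nR}$ values $l$ of uniform local randomness and each of about $e^{ni}$
indices $j$, a codeword is drawn i.i.d. from $p(u)$. Given $(s,l)$, the encoder looks for a $j$
making the codeword typical with $s$, which exists with high probability by covering
(`iidExp_fail_le`), and passes the codeword through the prefix channel $p(x|s,u)$.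

Bob need not decode the codeword. He lists the states $s'$ one of whose codewords is jointly typical
with $s'$ and $y$. A false $s'$ enters the list either through a codeword independent of the one
sent, which contributes exponent $i+R+H(S|Y,U)-I(U;Y)$, or by colliding with the true hash and
sharing the sent codeword, which contributes $H(S|Y,U)-\max(R_u,0)$. Both are at most
$H(S|Y,U)-R_u$, so $H(S^n|Y^n)\lesssim n(H(S|Y,U)-R_u)$ and the amplification is at least
$I(S;Y,U)+R_u$ per letter, up to vanishing terms.

For Eve, with $l$ independent of $S^n$, $I(S^n;Z^n)=I(S^n,l;Z^n)-\log|L|+H(l|S^n,Z^n)$, and the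
first term is at most about $nI(U,S;Z)$ by a likelihood-ratio bound. The trivial bound
$H(l|S^n,Z^n)\le\log|L|$ leaves $I(U,S;Z)$. If $I(U;Z)\ge I(U;S)$, a genie-aided Eve who knows the
state has a list of indices of exponent $i+R-I(U;Z)=0$, so the leakage drops to
$I(U,S;Z)-R=I(S;Z,U)$. The comparison of $I(U;Z)$ with $I(U;S)$ is exactly what decides the minimum
in the region.

The one-shot statement is `exists_code`. List sizes become entropies through
`natCondEntropy_le_of_list` and `natMutualInfo_le_of_density`, exponents come from typicality, and
`eventually_exists_block_code` and `eventually_exists_encoder` assemble the rates. -/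

lemma law_nonneg {P : Ω → ℝ} (hP : ∀ ω, 0 ≤ P ω) (f : Ω → A) (a : A) : 0 ≤ law P f a :=
  Finset.sum_nonneg fun ω _ => hP ω

lemma le_law {P : Ω → ℝ} (hP : ∀ ω, 0 ≤ P ω) (f : Ω → A) (ω : Ω) : P ω ≤ law P f (f ω) := by
  classical
  exact Finset.single_le_sum (f := P) (fun i _ => hP i) (by simp)

lemma law_eq_sum (P : Ω → ℝ) (f : Ω → A) [DecidableEq A] (a : A) :
    law P f a = ∑ ω, P ω * (if f ω = a then 1 else 0) := by
  classical
  rw [law, Finset.sum_filter]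
  refine Finset.sum_congr rfl fun ω _ => ?_
  by_cases h : f ω = a <;> simp [h]

variable [Fintype A]

lemma sum_law_mul (P : Ω → ℝ) (f : Ω → A) (F : A → ℝ) :
    ∑ a, law P f a * F a = ∑ ω, P ω * F (f ω) := by
  classical
  simp only [law, Finset.sum_mul]
  rw [← Finset.sum_fiberwise_of_maps_to (s := univ) (t := univ) (g := f) (by simp)]
  refine Finset.sum_congr rfl fun a _ => ?_
  refine Finset.sum_congr (by congr) fun ω hω => ?_
  rw [(Finset.mem_filter.1 hω).2]

lemma sum_law (P : Ω → ℝ) (f : Ω → A) : ∑ a, law P f a = ∑ ω, P ω := by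
  simpa using sum_law_mul P f (fun _ => 1)

lemma law_comp (P : Ω → ℝ) (f : Ω → A) (g : A → B) :
    law (law P f) g = law P (fun ω => g (f ω)) := by
  classical
  ext b
  rw [law_eq_sum, law_eq_sum, sum_law_mul]

/-- The Shannon entropy in nats, written as an expectation. -/
noncomputable def natEntropy (P : Ω → ℝ) (f : Ω → A) : ℝ :=
  ∑ ω, P ω * -Real.log (law P f (f ω))

lemma entropy_eq (P : Ω → ℝ) (f : Ω → A) : entropy P f = natEntropy P f / Real.log 2 := by
  rw [entropy, natEntropy, ← sum_law_mul P f (fun a => -Real.log (law P f a))]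
  simp [Real.negMulLog]

lemma natEntropy_congr {Ω' : Type*} [Fintype Ω'] {P : Ω → ℝ} {f : Ω → A} {P' : Ω' → ℝ}
    {f' : Ω' → A} (h : law P f = law P' f') : natEntropy P f = natEntropy P' f' := by
  rw [natEntropy, natEntropy, ← sum_law_mul P f (fun a => -Real.log (law P f a)),
    ← sum_law_mul P' f' (fun a => -Real.log (law P' f' a)), h]

lemma natEntropy_comp_equiv (P : Ω → ℝ) (f : Ω → A) (e : A ≃ B) :
    natEntropy P (fun ω => e (f ω)) = natEntropy P f := by
  classical
  refine Finset.sum_congr rfl fun ω _ => ?_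
  congr 3
  simp [law_eq_sum]

lemma mutualInfo_eq [Fintype B] (P : Ω → ℝ) (f : Ω → A) (g : Ω → B) :
    mutualInfo P f g =
      (natEntropy P f + natEntropy P g - natEntropy P (fun ω => (f ω, g ω))) / Real.log 2 := by
  rw [mutualInfo, condEntropy, entropy_eq, entropy_eq, entropy_eq]
  ring

/-- **Gibbs' inequality** for conditional entropies. -/
lemma natCondEntropy_le_crossEntropy [Fintype B] {P : Ω → ℝ} (hP : ∀ ω, 0 ≤ P ω) (f : Ω → A) (g : Ω → B)
    (q : B → A → ℝ) (hq : ∀ b a, 0 ≤ q b a) (hq1 : ∀ b, ∑ a, q b a ≤ 1)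
    (hqP : ∀ ω, 0 < P ω → 0 < q (g ω) (f ω)) :
    natEntropy P (fun ω => (f ω, g ω)) - natEntropy P g
      ≤ ∑ ω, P ω * -Real.log (q (g ω) (f ω)) := by
  set r : A × B → ℝ := law P (fun ω => (f ω, g ω)) with hr
  have hr0 : ∀ x, 0 ≤ r x := law_nonneg hP _
  have hg0 : ∀ x, 0 ≤ law P g x := law_nonneg hP _
  -- This is $\log x\le x-1$ at $x=q(f|g)\,P_g/P_{fg}$. Summing, the right side is at most $0$
  -- because each $q(\cdot|b)$ has mass at most one.
  have key : ∀ ω, P ω * (Real.log (q (g ω) (f ω)) + Real.log (law P g (g ω))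
      - Real.log (r (f ω, g ω)))
      ≤ P ω * (q (g ω) (f ω) * law P g (g ω) / r (f ω, g ω)) - P ω := by
    intro ω
    rcases (hP ω).eq_or_lt with h | h
    · simp [← h]
    have h1 := hqP ω h
    have h2 : 0 < law P g (g ω) := h.trans_le (le_law hP g ω)
    have h3 : 0 < r (f ω, g ω) := h.trans_le (le_law hP (fun ω => (f ω, g ω)) ω)
    rw [← Real.log_mul h1.ne' h2.ne', ← Real.log_div (by positivity) h3.ne']
    have := Real.log_le_sub_one_of_pos (x := q (g ω) (f ω) * law P g (g ω) / r (f ω, g ω))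
      (by positivity)
    nlinarith
  have hsum : ∑ ω, P ω * (q (g ω) (f ω) * law P g (g ω) / r (f ω, g ω)) ≤ ∑ ω, P ω := by
    rw [← sum_law_mul P (fun ω => (f ω, g ω)) (fun x => q x.2 x.1 * law P g x.2 / r x)]
    calc ∑ x, r x * (q x.2 x.1 * law P g x.2 / r x)
        ≤ ∑ x : A × B, q x.2 x.1 * law P g x.2 := by
          refine Finset.sum_le_sum fun x _ => ?_
          rcases (hr0 x).eq_or_lt with h | h
          · rw [← h, zero_mul]; exact mul_nonneg (hq _ _) (hg0 _)
          · rw [mul_div_cancel₀ _ h.ne']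
      _ = ∑ b, (∑ a, q b a) * law P g b := by
          rw [Fintype.sum_prod_type_right]
          simp [Finset.sum_mul]
      _ ≤ ∑ b, 1 * law P g b :=
          Finset.sum_le_sum fun b _ => mul_le_mul_of_nonneg_right (hq1 b) (hg0 b)
      _ = ∑ ω, P ω := by simp [sum_law]
  have := Finset.sum_le_sum fun ω (_ : ω ∈ univ) => key ω
  rw [Finset.sum_sub_distrib] at this
  simp only [mul_add, mul_sub, Finset.sum_add_distrib, Finset.sum_sub_distrib] at this
  simp only [natEntropy, mul_neg, Finset.sum_neg_distrib]
  linarith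

lemma natEntropy_le_crossEntropy {P : Ω → ℝ} (hP : ∀ ω, 0 ≤ P ω) (hP1 : ∑ ω, P ω = 1)
    (f : Ω → A) (q : A → ℝ) (hq : ∀ a, 0 ≤ q a) (hq1 : ∑ a, q a ≤ 1)
    (hqP : ∀ ω, 0 < P ω → 0 < q (f ω)) :
    natEntropy P f ≤ ∑ ω, P ω * -Real.log (q (f ω)) := by
  classical
  have h := natCondEntropy_le_crossEntropy hP f (fun _ => ()) (fun _ => q) (fun _ => hq)
    (fun _ => hq1) hqP
  have h1 : natEntropy P (fun _ : Ω => ()) = 0 := by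
    simp [natEntropy, law_eq_sum, hP1]
  have h2 : natEntropy P (fun ω => (f ω, ())) = natEntropy P f :=
    natEntropy_comp_equiv P f (Equiv.prodPUnit A).symm
  linarith

/-- Gibbs with a guess for $f$ that ignores $g$. It supplies the nonnegativity of the single-letter
mutual informations used as rates. -/
lemma natEntropy_prod_le [Fintype B] {P : Ω → ℝ} (hP : ∀ ω, 0 ≤ P ω) (hP1 : ∑ ω, P ω = 1)
    (f : Ω → A) (g : Ω → B) :
    natEntropy P (fun ω => (f ω, g ω)) ≤ natEntropy P f + natEntropy P g := by
  have := natCondEntropy_le_crossEntropy hP f g (fun _ => law P f) (fun _ => law_nonneg hP f)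
    (fun _ => by rw [sum_law, hP1]) (fun ω h => h.trans_le (le_law hP f ω))
  simp only [natEntropy] at this ⊢
  linarith

/-- Conditional entropy is bounded by the size of a list which contains the variable, given the
side information, outside of an event of small probability. -/
lemma natCondEntropy_le_of_list [Fintype B] [Nonempty A] {P : Ω → ℝ} (hP : ∀ ω, 0 ≤ P ω)
    (hP1 : ∑ ω, P ω = 1) (f : Ω → A) (g : Ω → B) (G : Ω → Prop)
    [DecidablePred G] (Λ : B → Finset A)
    (hG : ∀ ω, G ω → f ω ∈ Λ (g ω)) {K : ℝ} (hK : 1 ≤ K) :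
    natEntropy P (fun ω => (f ω, g ω)) - natEntropy P g
      ≤ Real.log 2 + Real.log K + (∑ ω, P ω * if G ω then 0 else 1) * Real.log (Fintype.card A)
        + (∑ ω, P ω * if G ω then ((Λ (g ω)).card : ℝ) else 0) / K := by
  classical
  have hA : (0 : ℝ) < Fintype.card A := by exact_mod_cast Fintype.card_pos
  -- The guess mixes the uniform law on the list with the uniform law on all of `A`. The mixture
  -- costs $\log 2$ and keeps the cross entropy finite when the list misses.
  set q : B → A → ℝ := fun b a =>
    (if a ∈ Λ b then ((Λ b).card : ℝ)⁻¹ else 0) / 2 + (Fintype.card A : ℝ)⁻¹ / 2 with hq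
  have hq0 : ∀ b a, (Fintype.card A : ℝ)⁻¹ / 2 ≤ q b a := by
    intro b a
    have : (0 : ℝ) ≤ (if a ∈ Λ b then ((Λ b).card : ℝ)⁻¹ else 0) / 2 := by positivity
    simp only [hq]
    linarith
  have hqpos : ∀ b a, 0 < q b a := fun b a => lt_of_lt_of_le (by positivity) (hq0 b a)
  refine (natCondEntropy_le_crossEntropy hP f g q (fun b a => (hqpos b a).le) ?_
    (fun ω _ => hqpos _ _)).trans ?_
  · intro b
    simp only [hq, Finset.sum_add_distrib, ← Finset.sum_div, Finset.sum_ite_mem, univ_inter,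
      Finset.sum_const, Finset.card_univ, nsmul_eq_mul]
    rw [mul_inv_cancel₀ hA.ne']
    have : ((Λ b).card : ℝ) * ((Λ b).card : ℝ)⁻¹ ≤ 1 := mul_inv_le_one
    linarith
  · have hlogA : 0 ≤ Real.log (Fintype.card A) :=
      Real.log_nonneg (by exact_mod_cast Fintype.card_pos)
    have hlogK : 0 ≤ Real.log K := Real.log_nonneg hK
    have key : ∀ ω, P ω * -Real.log (q (g ω) (f ω)) ≤ P ω * (Real.log 2 + Real.log K) +
        (P ω * if G ω then 0 else 1) * Real.log (Fintype.card A)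
        + (P ω * if G ω then ((Λ (g ω)).card : ℝ) else 0) / K := by
      intro ω
      rw [mul_assoc, mul_div_assoc, ← mul_add, ← mul_add]
      refine mul_le_mul_of_nonneg_left ?_ (hP ω)
      by_cases h : G ω
      · have hmem := hG ω h
        have hc : (0 : ℝ) < (Λ (g ω)).card := by
          exact_mod_cast Finset.card_pos.2 ⟨_, hmem⟩
        have h1 : ((Λ (g ω)).card : ℝ)⁻¹ / 2 ≤ q (g ω) (f ω) := by
          simp only [hq, if_pos hmem]
          have : 0 ≤ (Fintype.card A : ℝ)⁻¹ / 2 := by positivity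
          linarith
        have h2 := Real.log_le_log (by positivity) h1
        rw [Real.log_div (by positivity) (by norm_num), Real.log_inv] at h2
        -- The bound $\log|\Lambda|\le\log K+|\Lambda|/K-1$ replaces Jensen's inequality, so only
        -- the expected list size is needed.
        have h3 := Real.log_le_sub_one_of_pos (x := ((Λ (g ω)).card : ℝ) / K) (by positivity)
        rw [Real.log_div hc.ne' (by positivity)] at h3
        simp only [h, if_true]
        linarith
      · have h2 := Real.log_le_log (by positivity) (hq0 (g ω) (f ω))
        rw [Real.log_div (by positivity) (by norm_num), Real.log_inv] at h2
        simp only [h, if_false, zero_div]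
        linarith
    refine (Finset.sum_le_sum fun ω _ => key ω).trans_eq ?_
    simp only [Finset.sum_add_distrib, ← Finset.sum_mul, ← Finset.sum_div, hP1]
    ring

/-- Mutual information is bounded by a bound on the likelihood ratio outside of an event of small
probability. -/
lemma natMutualInfo_le_of_density [Fintype B] [Nonempty B] {P : Ω → ℝ} (hP : ∀ ω, 0 ≤ P ω)
    (hP1 : ∑ ω, P ω = 1) (f : Ω → A) (g : Ω → B) (G : Ω → Prop)
    [DecidablePred G] (q : B → ℝ) (hq : ∀ b, 0 ≤ q b)
    (hq1 : ∑ b, q b ≤ 1) {ζ : ℝ} (hζ : 1 ≤ ζ)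
    (hG : ∀ ω, G ω → law P (fun ω => (f ω, g ω)) (f ω, g ω) ≤ ζ * q (g ω) * law P f (f ω)) :
    natEntropy P f + natEntropy P g - natEntropy P (fun ω => (f ω, g ω))
      ≤ Real.log 2 + Real.log ζ
        + (∑ ω, P ω * if G ω then 0 else 1) * Real.log (Fintype.card B) := by
  classical
  have hB : (0 : ℝ) < Fintype.card B := by exact_mod_cast Fintype.card_pos
  have hlogB : 0 ≤ Real.log (Fintype.card B) :=
    Real.log_nonneg (by exact_mod_cast Fintype.card_pos)
  have hlogζ : 0 ≤ Real.log ζ := Real.log_nonneg hζ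
  set q' : B → ℝ := fun b => q b / 2 + (Fintype.card B : ℝ)⁻¹ / 2 with hq'
  have hq0 : ∀ b, (Fintype.card B : ℝ)⁻¹ / 2 ≤ q' b := by
    intro b; have := hq b; simp only [hq']; linarith
  have hqpos : ∀ b, 0 < q' b := fun b => lt_of_lt_of_le (by positivity) (hq0 b)
  have h := natEntropy_le_crossEntropy hP hP1 g q' (fun b => (hqpos b).le) (by
    simp only [hq', Finset.sum_add_distrib, ← Finset.sum_div, Finset.sum_const, Finset.card_univ,
      nsmul_eq_mul]
    rw [mul_inv_cancel₀ hB.ne']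
    linarith) (fun ω _ => hqpos _)
  set r : A × B → ℝ := law P (fun ω => (f ω, g ω)) with hr
  have key : ∀ ω, P ω * -Real.log (law P f (f ω)) + P ω * -Real.log (q' (g ω))
      - P ω * -Real.log (r (f ω, g ω)) ≤ P ω * (Real.log 2 + Real.log ζ)
        + (P ω * if G ω then 0 else 1) * Real.log (Fintype.card B) := by
    intro ω
    rw [mul_assoc, ← mul_add, ← mul_add, ← mul_sub]
    rcases (hP ω).eq_or_lt with h0 | h0
    · simp [← h0]
    refine mul_le_mul_of_nonneg_left ?_ (hP ω)
    have h2 : 0 < law P f (f ω) := h0.trans_le (le_law hP f ω)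
    have h3 : 0 < r (f ω, g ω) := h0.trans_le (le_law hP (fun ω => (f ω, g ω)) ω)
    have h4 := hqpos (g ω)
    by_cases hg : G ω
    · have h5 : r (f ω, g ω) ≤ 2 * ζ * q' (g ω) * law P f (f ω) := by
        refine (hG ω hg).trans (mul_le_mul_of_nonneg_right ?_ h2.le)
        have : 0 ≤ ζ * (Fintype.card B : ℝ)⁻¹ := by positivity
        simp only [hq']
        linarith
      have h6 := Real.log_le_log h3 h5
      rw [Real.log_mul (by positivity) h2.ne', Real.log_mul (by positivity) h4.ne',
        Real.log_mul (by norm_num) (by positivity)] at h6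
      simp only [hg, if_true]
      linarith
    -- Outside `G` only $P_{fg}\le P_f$ is available. With the uniform half of `q'` the log ratio is
    -- at most $\log 2+\log|B|$.
    · have h5 : r (f ω, g ω) ≤ law P f (f ω) := by
        rw [hr, law_eq_sum, law_eq_sum]
        refine Finset.sum_le_sum fun ω' _ => mul_le_mul_of_nonneg_left ?_ (hP ω')
        simp only [Prod.mk.injEq]
        split_ifs <;> simp_all
      have h6 := Real.log_le_log h3 h5
      have h7 := Real.log_le_log (by positivity) (hq0 (g ω))
      rw [Real.log_div (by positivity) (by norm_num), Real.log_inv] at h7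
      simp only [hg, if_false]
      linarith
  have hsum := Finset.sum_le_sum fun ω (_ : ω ∈ univ) => key ω
  simp only [Finset.sum_add_distrib, Finset.sum_sub_distrib, ← Finset.sum_mul, hP1] at hsum
  simp only [natEntropy] at h ⊢
  linarith

end Entropy

/-! ### Expectations over independent, identically distributed families -/

section IidExpectation

variable {ι α : Type*} [Fintype ι] [DecidableEq ι] [Fintype α]

/-- The expectation of `F` of a family of independent variables with common law `p`. -/
noncomputable def iidExp (p : α → ℝ) (F : (ι → α) → ℝ) : ℝ :=
  ∑ c : ι → α, (∏ i, p (c i)) * F c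

lemma iidExp_prod (p : α → ℝ) (f : ι → α → ℝ) :
    iidExp p (fun c : ι → α => ∏ i, f i (c i)) = ∏ i, ∑ x, p x * f i x := by
  rw [Fintype.prod_sum]
  simp [iidExp, Finset.prod_mul_distrib]

lemma iidExp_mono {p : α → ℝ} (hp : ∀ x, 0 ≤ p x) {F G : (ι → α) → ℝ} (h : ∀ c, F c ≤ G c) :
    iidExp p F ≤ iidExp p G :=
  Finset.sum_le_sum fun c _ =>
    mul_le_mul_of_nonneg_left (h c) (Finset.prod_nonneg fun i _ => hp (c i))

lemma iidExp_add (p : α → ℝ) (F G : (ι → α) → ℝ) :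
    iidExp p (fun c => F c + G c) = iidExp p F + iidExp p G := by
  simp [iidExp, mul_add, Finset.sum_add_distrib]

lemma iidExp_const_mul (p : α → ℝ) (a : ℝ) (F : (ι → α) → ℝ) :
    iidExp p (fun c => a * F c) = a * iidExp p F := by
  simp only [iidExp, Finset.mul_sum]
  exact Finset.sum_congr rfl fun _ _ => by ring

lemma iidExp_sum {κ : Type*} (s : Finset κ) (p : α → ℝ) (F : κ → (ι → α) → ℝ) :
    iidExp p (fun c => ∑ k ∈ s, F k c) = ∑ k ∈ s, iidExp p (F k) := by
  simp only [iidExp, Finset.mul_sum]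
  exact Finset.sum_comm

lemma iidExp_const {p : α → ℝ} (hp1 : ∑ x, p x = 1) (a : ℝ) :
    iidExp p (fun _ : ι → α => a) = a := by
  have := iidExp_prod (ι := ι) p (fun _ _ => 1)
  have h2 := iidExp_const_mul (ι := ι) p a (fun _ => 1)
  simp_all

lemma iidExp_apply_mul_apply {p : α → ℝ} (hp1 : ∑ x, p x = 1) (F G : α → ℝ) {a b : ι}
    (hab : a ≠ b) :
    iidExp p (fun c : ι → α => F (c a) * G (c b)) = (∑ x, p x * F x) * ∑ x, p x * G x := by
  -- Functions of one or two coordinates are written as full products with factor $1$ elsewhere, so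
  -- that independence is the product formula `iidExp_prod`.
  have h := iidExp_prod p (fun i x => (if i = a then F x else 1) * (if i = b then G x else 1))
  have h1 : ∀ c : ι → α, F (c a) * G (c b)
      = ∏ i, ((if i = a then F (c i) else 1) * (if i = b then G (c i) else 1)) := by
    intro c
    rw [Finset.prod_mul_distrib]
    simp
  simp only [h1]
  rw [h, ← Finset.mul_prod_erase univ _ (mem_univ a),
    ← Finset.mul_prod_erase (univ.erase a) _ (Finset.mem_erase.2 ⟨hab.symm, mem_univ b⟩),
    Finset.prod_eq_one, mul_one]
  · simp [hab, hab.symm]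
  · intro i hi
    simp only [Finset.mem_erase] at hi
    simp [hi.1, hi.2.1, hp1]

lemma iidExp_apply {p : α → ℝ} (hp1 : ∑ x, p x = 1) (F : α → ℝ) (a : ι) :
    iidExp p (fun c : ι → α => F (c a)) = ∑ x, p x * F x := by
  have h := iidExp_prod p (fun i x => if i = a then F x else 1)
  have h1 : ∀ c : ι → α, F (c a) = ∏ i, (if i = a then F (c i) else 1) := by
    intro c
    simp
  simp only [h1]
  rw [h, ← Finset.mul_prod_erase univ _ (mem_univ a), Finset.prod_eq_one, mul_one]
  · simp
  · intro i hi
    simp [(Finset.mem_erase.1 hi).1, hp1]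

/-- The expectation of a function of two coordinates. -/
lemma iidExp_apply_apply {p : α → ℝ} (hp1 : ∑ x, p x = 1) (F : α → α → ℝ) {a b : ι}
    (hab : a ≠ b) :
    iidExp p (fun c : ι → α => F (c a) (c b)) = ∑ x, ∑ y, p x * p y * F x y := by
  classical
  have h1 : ∀ c : ι → α, F (c a) (c b)
      = ∑ x, (if c a = x then 1 else 0) * F x (c b) := by
    intro c
    simp
  simp only [h1]
  rw [iidExp_sum]
  refine Finset.sum_congr rfl fun x _ => ?_
  rw [iidExp_apply_mul_apply hp1 (fun t => if t = x then 1 else 0) (F x) hab]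
  simp [Finset.mul_sum, mul_assoc]

/-- A set of independent coordinates `e j` misses the set `D` with probability `(1 - p(D)) ^ J`. -/
lemma iidExp_forall_not {p : α → ℝ} (hp1 : ∑ x, p x = 1) {κ : Type*} [Fintype κ]
    (e : κ → ι) (he : Function.Injective e) (D : α → Prop) [DecidablePred D] :
    iidExp p (fun c : ι → α => if ∀ j, ¬ D (c (e j)) then (1 : ℝ) else 0)
      = (1 - ∑ x, p x * if D x then 1 else 0) ^ Fintype.card κ := by
  classical
  have h := iidExp_prod p
    (fun i x => if i ∈ univ.image e then (if D x then (0 : ℝ) else 1) else 1)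
  have h1 : ∀ c : ι → α, (if ∀ j, ¬ D (c (e j)) then (1 : ℝ) else 0)
      = ∏ i, (if i ∈ univ.image e then (if D (c i) then (0 : ℝ) else 1) else 1) := by
    intro c
    rw [Finset.prod_ite_mem, univ_inter, Finset.prod_image he.injOn]
    by_cases hD : ∀ j, ¬ D (c (e j))
    · simp [hD]
    · rw [if_neg hD]
      push Not at hD
      obtain ⟨j, hj⟩ := hD
      exact (Finset.prod_eq_zero (mem_univ j) (by simp [hj])).symm
  simp only [h1]
  have h2 : ∀ i, (∑ x, p x * if i ∈ univ.image e then (if D x then (0 : ℝ) else 1) else 1)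
      = if i ∈ univ.image e then (1 - ∑ x, p x * if D x then 1 else 0) else 1 := by
    intro i
    split_ifs
    · rw [eq_sub_iff_add_eq, ← Finset.sum_add_distrib]
      refine (Finset.sum_congr rfl fun x _ => ?_).trans hp1
      split_ifs <;> simp
    · simp [hp1]
  rw [h, Finset.prod_congr rfl fun i _ => h2 i, Finset.prod_ite_mem, univ_inter,
    Finset.prod_image he.injOn]
  simp

/-- The probabilistic method: if every value exceeded the mean, so would the mean itself. Strictness
needs one family of positive weight, which exists because the total weight is one. -/
lemma exists_le_iidExp {p : α → ℝ} (hp : ∀ x, 0 ≤ p x) (hp1 : ∑ x, p x = 1) (F : (ι → α) → ℝ) :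
    ∃ c, F c ≤ iidExp p F := by
  by_contra! h
  have h1 : iidExp p (fun _ : ι → α => iidExp p F) < iidExp p F := by
    refine Finset.sum_lt_sum (fun c _ => mul_le_mul_of_nonneg_left (h c).le
      (Finset.prod_nonneg fun i _ => hp (c i))) ?_
    by_contra! h2
    have h3 : ∀ c : ι → α, ∏ i, p (c i) = 0 := fun c => by
      by_contra h4
      exact absurd (h2 c (mem_univ c)) (not_le.2 (mul_lt_mul_of_pos_left (h c)
        (lt_of_le_of_ne (Finset.prod_nonneg fun i _ => hp (c i)) (Ne.symm h4))))
    have h5 := iidExp_const (ι := ι) hp1 1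
    simp [iidExp, h3] at h5
  rw [iidExp_const hp1] at h1
  exact lt_irrefl _ h1

end IidExpectation

/-! ### One-shot random coding -/

section RandomCoding

variable {𝒮 𝒰 𝒴 𝒵 I J L : Type*} [Fintype 𝒮] [Fintype 𝒰] [Fintype 𝒴] [Fintype 𝒵] [Fintype I]
  [Fintype J] [Fintype L]

/-- The covering estimate: $(1-y)^N\le e^{-Ny}\le e^{-tx}$, and convexity of $\exp$ on the segment
from $0$ to $-t$ gives $e^{-tx}\le 1-x+xe^{-t}$. Here $y$ is the probability that one random
codeword fits and $x$ the probability under the true conditional law. -/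
lemma one_sub_pow_le {x y t : ℝ} (hx0 : 0 ≤ x) (hx1 : x ≤ 1) (hy1 : y ≤ 1) {N : ℕ}
    (hxy : t * x ≤ N * y) : (1 - y) ^ N ≤ 1 - x + Real.exp (-t) := by
  have h1 : (1 - y) ^ N ≤ Real.exp (-(N * y)) := by
    calc (1 - y) ^ N ≤ (Real.exp (-y)) ^ N :=
          pow_le_pow_left₀ (by linarith) (Real.one_sub_le_exp_neg y) N
      _ = Real.exp (-(N * y)) := by rw [← Real.exp_nat_mul]; ring_nf
  have h2 := convexOn_exp.2 (Set.mem_univ 0) (Set.mem_univ (-t))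
    (sub_nonneg.2 hx1) hx0 (by ring)
  simp only [smul_eq_mul, mul_zero, zero_add, Real.exp_zero, mul_one] at h2
  have h3 : Real.exp (-(N * y)) ≤ Real.exp (x * -t) := Real.exp_le_exp.2 (by linarith)
  have h4 : x * Real.exp (-t) ≤ Real.exp (-t) :=
    mul_le_of_le_one_left (Real.exp_pos _).le hx1
  linarith

open Classical in
/-- Among the codewords `u s j l`, where `j` varies, select one which satisfies `A s`, if any. -/
noncomputable def selectWord [Nonempty J] (A : 𝒮 → 𝒰 → Prop) (u : 𝒮 → J → L → 𝒰) (s : 𝒮) (l : L) :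
    𝒰 :=
  if h : ∃ j, A s (u s j l) then u s h.choose l else u s (Classical.arbitrary J) l

lemma exists_selectWord_eq [Nonempty J] (A : 𝒮 → 𝒰 → Prop) (u : 𝒮 → J → L → 𝒰) (s : 𝒮) (l : L) :
    ∃ j, selectWord A u s l = u s j l := by
  unfold selectWord
  split_ifs with h
  exacts [⟨_, rfl⟩, ⟨_, rfl⟩]

lemma selectWord_iff [Nonempty J] (A : 𝒮 → 𝒰 → Prop) (u : 𝒮 → J → L → 𝒰) (s : 𝒮) (l : L) :
    A s (selectWord A u s l) ↔ ∃ j, A s (u s j l) := by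
  refine ⟨fun h => ?_, fun h => ?_⟩
  · obtain ⟨j, hj⟩ := exists_selectWord_eq A u s l
    exact ⟨j, hj ▸ h⟩
  · rw [selectWord, dif_pos h]
    exact h.choose_spec

-- The selected $j$ depends on the whole codebook. Bounding by the sum over all $j$ removes this
-- dependence at the price of a factor $|J|$, which the small probability of `A s` under `Q`
-- compensates.
open Classical in
lemma selectWord_sum_le [Nonempty J] (A : 𝒮 → 𝒰 → Prop) (u : 𝒮 → J → L → 𝒰) (s : 𝒮) (l : L)
    (F : 𝒰 → ℝ) (hF : ∀ x, 0 ≤ F x) :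
    (if A s (selectWord A u s l) then F (selectWord A u s l) else 0)
      ≤ ∑ j, if A s (u s j l) then F (u s j l) else 0 := by
  obtain ⟨j, hj⟩ := exists_selectWord_eq A u s l
  rw [hj]
  exact Finset.single_le_sum (f := fun j => if A s (u s j l) then F (u s j l) else 0)
    (fun j _ => by split_ifs <;> simp [hF]) (mem_univ j)

/-- Union bound in counting form: a list member is charged for every witness `k` that puts it on the
list. -/
lemma card_filter_exists_le {ι κ : Type*} [Fintype κ] (s : Finset ι)
    (R : ι → κ → Prop) [∀ i, DecidablePred (R i)] [DecidablePred fun i => ∃ k, R i k] :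
    ((s.filter fun i => ∃ k, R i k).card : ℝ) ≤ ∑ i ∈ s, ∑ k, if R i k then 1 else 0 := by
  rw [Finset.card_filter]
  push_cast
  refine Finset.sum_le_sum fun i _ => ?_
  split_ifs with h
  · obtain ⟨k, hk⟩ := h
    exact (by simp [hk] : (1 : ℝ) = if R i k then 1 else 0).le.trans
      (Finset.single_le_sum (f := fun k => if R i k then (1 : ℝ) else 0)
        (fun k _ => by split_ifs <;> simp) (mem_univ k))
  · exact Finset.sum_nonneg fun k _ => by split_ifs <;> simp

variable [Nonempty I] [Nonempty J] [Nonempty L] [DecidableEq 𝒮] [DecidableEq L]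

open Classical in
/-- The encoder fails with small probability, on average over the codebook. -/
lemma iidExp_fail_le (A : 𝒮 → 𝒰 → Prop) {Q : 𝒰 → ℝ} (hQ : ∀ u, 0 ≤ Q u) (hQ1 : ∑ u, Q u = 1)
    {κ : 𝒮 → 𝒰 → ℝ} (hκ : ∀ s u, 0 ≤ κ s u) (hκ1 : ∀ s, ∑ u, κ s u = 1) {α : ℝ} (hα : 0 < α)
    (hA : ∀ s u, A s u → κ s u ≤ α * Q u) (h : 𝒮 → I) (s : 𝒮) (l : L) :
    iidExp Q (fun c : I × J × L → 𝒰 =>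
        if A s (selectWord A (fun s j l => c (h s, j, l)) s l) then (0 : ℝ) else 1)
      ≤ (∑ u, κ s u * if A s u then 0 else 1) + Real.exp (-(Fintype.card J / α)) := by
  have h1 := iidExp_forall_not hQ1 (fun j : J => (h s, j, l)) (fun a b hab => by simpa using hab)
    (A s)
  have h2 : ∀ c : I × J × L → 𝒰,
      (if A s (selectWord A (fun s j l => c (h s, j, l)) s l) then (0 : ℝ) else 1)
        = if ∀ j, ¬ A s (c (h s, j, l)) then 1 else 0 := by
    intro c
    simp only [selectWord_iff, ← not_exists]
    split_ifs <;> rfl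
  simp only [h2]
  rw [h1]
  have h3 : (∑ u, κ s u * if A s u then 0 else 1)
      = 1 - ∑ u, κ s u * if A s u then 1 else 0 := by
    rw [eq_sub_iff_add_eq, ← Finset.sum_add_distrib]
    refine (Finset.sum_congr rfl fun u _ => ?_).trans (hκ1 s)
    split_ifs <;> simp
  rw [h3]
  refine one_sub_pow_le (Finset.sum_nonneg fun u _ => mul_nonneg (hκ s u) ?_) ?_ ?_ ?_
  · split_ifs <;> simp
  · refine (Finset.sum_le_sum fun u _ => ?_).trans_eq (hκ1 s)
    split_ifs <;> simp [hκ]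
  · refine (Finset.sum_le_sum fun u _ => ?_).trans_eq hQ1
    split_ifs <;> simp [hQ]
  · rw [div_mul_eq_mul_div, mul_div_assoc]
    refine mul_le_mul_of_nonneg_left ?_ (Nat.cast_nonneg _)
    rw [div_le_iff₀ hα, Finset.sum_mul]
    refine Finset.sum_le_sum fun u _ => ?_
    split_ifs with hu
    · simpa [mul_comm] using hA s u hu
    · simp

open Classical in
/-- Upper bound on the expected size of Bob's list of false state sequences, for a fixed state. -/
lemma iidExp_falseStates_le (A : 𝒮 → 𝒰 → Prop) {Q : 𝒰 → ℝ} (hQ : ∀ u, 0 ≤ Q u)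
    (hQ1 : ∑ u, Q u = 1) {κ : 𝒮 → 𝒰 → ℝ} (hκ : ∀ s u, 0 ≤ κ s u) (hκ1 : ∀ s, ∑ u, κ s u = 1)
    {α βa βb : ℝ} (hα : 0 ≤ α) (hA : ∀ s u, A s u → Q u ≤ α * κ s u)
    {V : 𝒮 → 𝒰 → 𝒴 → ℝ} (hV : ∀ s u y, 0 ≤ V s u y) (hV1 : ∀ s u, ∑ y, V s u y = 1)
    (T : 𝒮 → 𝒰 → 𝒴 → Prop)
    (ha : ∀ y, ∑ s, ∑ u, Q u * (if T s u y then 1 else 0) ≤ βa)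
    (hb : ∀ u y, ∑ s, (if T s u y then (1 : ℝ) else 0) ≤ βb) (hβa : 0 ≤ βa) (hβb : 0 ≤ βb)
    (s : 𝒮) (l : L) :
    iidExp (fun _ : I => (Fintype.card I : ℝ)⁻¹) (fun h : 𝒮 → I =>
      iidExp Q (fun c : I × J × L → 𝒰 =>
        ∑ j : J, ∑ s' ∈ univ.erase s, ∑ k : J × L,
          if A s (c (h s, j, l)) then
            ∑ y, V s (c (h s, j, l)) y * (if T s' (c (h s', k)) y then 1 else 0) else 0))
      ≤ Fintype.card J * α * (Fintype.card J * Fintype.card L * βa + βb / Fintype.card I) := by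
  set Φ : 𝒮 → 𝒰 → 𝒰 → ℝ := fun s' u u' =>
    if A s u then ∑ y, V s u y * (if T s' u' y then 1 else 0) else 0 with hΦ
  have hΦ0 : ∀ s' u u', 0 ≤ Φ s' u u' := by
    intro s' u u'
    simp only [hΦ]
    split_ifs
    · exact Finset.sum_nonneg fun y _ => mul_nonneg (hV _ _ _) (by split_ifs <;> simp)
    · exact le_rfl
  set a : 𝒮 → ℝ := fun s' => ∑ u, ∑ u', Q u * Q u' * Φ s' u u' with ha_def
  set b : 𝒮 → ℝ := fun s' => ∑ u, Q u * Φ s' u u with hb_def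
  have ha0 : ∀ s', 0 ≤ a s' := fun s' => Finset.sum_nonneg fun u _ => Finset.sum_nonneg fun u' _ =>
    mul_nonneg (mul_nonneg (hQ _) (hQ _)) (hΦ0 _ _ _)
  have hb0 : ∀ s', 0 ≤ b s' := fun s' => Finset.sum_nonneg fun u _ =>
    mul_nonneg (hQ _) (hΦ0 _ _ _)
  -- Change of measure: under the codebook law the set `A s` has mass at most $\alpha$. Together
  -- with the sum over $j$ this produces the factor $|J|\alpha$, which is subexponential up to
  -- $\delta$ in the application.
  have hQA : ∑ u, Q u * (if A s u then 1 else 0) ≤ α := by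
    calc ∑ u, Q u * (if A s u then 1 else 0) ≤ ∑ u, α * κ s u := by
          refine Finset.sum_le_sum fun u _ => ?_
          split_ifs with hu
          · simpa using hA s u hu
          · simpa using mul_nonneg hα (hκ s u)
      _ = α := by rw [← Finset.mul_sum, hκ1, mul_one]
  have hsa : ∑ s', a s' ≤ α * βa := by
    have h1 : ∑ s', a s' = ∑ u, Q u * (if A s u then 1 else 0) *
        ∑ y, V s u y * ∑ s', ∑ u', Q u' * (if T s' u' y then 1 else 0) := by
      simp only [ha_def, hΦ, Finset.mul_sum]
      rw [Finset.sum_comm]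
      refine Finset.sum_congr rfl fun u _ => ?_
      rw [Finset.sum_comm' (t' := univ) (s' := fun _ => univ) (by simp)]
      rw [Finset.sum_comm]
      conv_rhs => rw [Finset.sum_comm]
      refine Finset.sum_congr rfl fun s' _ => ?_
      rw [Finset.sum_comm]
      refine Finset.sum_congr rfl fun u' _ => ?_
      split_ifs
      · rw [Finset.mul_sum]
        exact Finset.sum_congr rfl fun y _ => by ring
      · simp
    rw [h1]
    calc _ ≤ ∑ u, Q u * (if A s u then 1 else 0) * βa := by
          refine Finset.sum_le_sum fun u _ => mul_le_mul_of_nonneg_left ?_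
            (mul_nonneg (hQ u) (by split_ifs <;> simp))
          calc _ ≤ ∑ y, V s u y * βa :=
                Finset.sum_le_sum fun y _ => mul_le_mul_of_nonneg_left (ha y) (hV _ _ _)
            _ = βa := by rw [← Finset.sum_mul, hV1, one_mul]
      _ ≤ α * βa := by
          rw [← Finset.sum_mul]
          exact mul_le_mul_of_nonneg_right hQA hβa
  have hsb : ∑ s', b s' ≤ α * βb := by
    have h1 : ∑ s', b s' = ∑ u, Q u * (if A s u then 1 else 0) *
        ∑ y, V s u y * ∑ s', (if T s' u y then 1 else 0) := by
      simp only [hb_def, hΦ, Finset.mul_sum]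
      rw [Finset.sum_comm]
      refine Finset.sum_congr rfl fun u _ => ?_
      conv_rhs => rw [Finset.sum_comm]
      refine Finset.sum_congr rfl fun s' _ => ?_
      split_ifs
      · rw [Finset.mul_sum]
        exact Finset.sum_congr rfl fun y _ => by ring
      · simp
    rw [h1]
    calc _ ≤ ∑ u, Q u * (if A s u then 1 else 0) * βb := by
          refine Finset.sum_le_sum fun u _ => mul_le_mul_of_nonneg_left ?_
            (mul_nonneg (hQ u) (by split_ifs <;> simp))
          calc _ ≤ ∑ y, V s u y * βb :=
                Finset.sum_le_sum fun y _ => mul_le_mul_of_nonneg_left (hb u y) (hV _ _ _)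
            _ = βb := by rw [← Finset.sum_mul, hV1, one_mul]
      _ ≤ α * βb := by
          rw [← Finset.sum_mul]
          exact mul_le_mul_of_nonneg_right hQA hβb
  have hI : (0 : ℝ) < Fintype.card I := by exact_mod_cast Fintype.card_pos
  have hunif : ∑ _i : I, (Fintype.card I : ℝ)⁻¹ = 1 := by
    simp
  -- Two codebook entries are either the same entry, which requires a hash collision and equal
  -- indices, or independent. The first case costs `b s'`, the second `a s'`.
  have hterm : ∀ (h : 𝒮 → I) (j : J) (s' : 𝒮) (k : J × L),
      iidExp Q (fun c : I × J × L → 𝒰 => Φ s' (c (h s, j, l)) (c (h s', k)))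
        ≤ a s' + (if k = (j, l) then (if h s' = h s then b s' else 0) else 0) := by
    intro h j s' k
    by_cases hk : (h s, j, l) = (h s', k)
    · rw [← hk, iidExp_apply hQ1 (fun u => Φ s' u u)]
      simp only [Prod.mk.injEq] at hk
      rw [if_pos hk.2.symm, if_pos hk.1.symm]
      exact le_add_of_nonneg_left (ha0 s')
    · rw [iidExp_apply_apply hQ1 (Φ s') hk]
      refine le_add_of_nonneg_right ?_
      split_ifs <;> simp [hb0]
  -- Distinct states have independent uniform hashes, so they collide with probability $1/|I|$. This
  -- is why the true state is erased from the sum.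
  have hcoll : ∀ s' ∈ univ.erase s, iidExp (fun _ : I => (Fintype.card I : ℝ)⁻¹)
      (fun h : 𝒮 → I => if h s' = h s then b s' else 0) = b s' / Fintype.card I := by
    intro s' hs'
    rw [iidExp_apply_apply hunif (fun x y => if x = y then b s' else 0) (Finset.ne_of_mem_erase hs')]
    simp
    field_simp
  calc _ ≤ iidExp (fun _ : I => (Fintype.card I : ℝ)⁻¹) (fun h : 𝒮 → I =>
        ∑ j : J, ∑ s' ∈ univ.erase s, ∑ k : J × L,
          (a s' + (if k = (j, l) then (if h s' = h s then b s' else 0) else 0))) := by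
        refine iidExp_mono (fun _ => by positivity) fun h => ?_
        rw [iidExp_sum]
        refine Finset.sum_le_sum fun j _ => ?_
        rw [iidExp_sum]
        refine Finset.sum_le_sum fun s' _ => ?_
        rw [iidExp_sum]
        exact Finset.sum_le_sum fun k _ => hterm h j s' k
    _ = ∑ _j : J, ∑ s' ∈ univ.erase s,
          (Fintype.card J * Fintype.card L * a s' + b s' / Fintype.card I) := by
        rw [iidExp_sum]
        refine Finset.sum_congr rfl fun j _ => ?_
        rw [iidExp_sum]
        refine Finset.sum_congr rfl fun s' hs' => ?_
        simp only [Finset.sum_add_distrib, Finset.sum_ite_eq', mem_univ, if_true]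
        rw [iidExp_add, hcoll s' hs', iidExp_const hunif]
        simp
    _ ≤ ∑ _j : J, ∑ s', (Fintype.card J * Fintype.card L * a s' + b s' / Fintype.card I) := by
        refine Finset.sum_le_sum fun j _ => Finset.sum_le_sum_of_subset_of_nonneg
          (Finset.erase_subset _ _) fun s' _ _ => ?_
        have := ha0 s'; have := hb0 s'
        positivity
    _ = Fintype.card J * (Fintype.card J * Fintype.card L * ∑ s', a s'
          + (∑ s', b s') / Fintype.card I) := by
        rw [Finset.sum_const, Finset.sum_add_distrib, Finset.mul_sum, Finset.sum_div]
        simp [mul_add]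
    _ ≤ Fintype.card J * (Fintype.card J * Fintype.card L * (α * βa)
          + (α * βb) / Fintype.card I) := by gcongr
    _ = _ := by ring

open Classical in
/-- Upper bound on the expected number of false local-randomness indices on Eve's list, for a
fixed state. -/
lemma iidExp_falseIndices_le (A : 𝒮 → 𝒰 → Prop) {Q : 𝒰 → ℝ} (hQ : ∀ u, 0 ≤ Q u)
    (hQ1 : ∑ u, Q u = 1) {κ : 𝒮 → 𝒰 → ℝ} (hκ : ∀ s u, 0 ≤ κ s u) (hκ1 : ∀ s, ∑ u, κ s u = 1)
    {α γ : ℝ} (hα : 0 ≤ α) (hA : ∀ s u, A s u → Q u ≤ α * κ s u)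
    {V : 𝒮 → 𝒰 → 𝒵 → ℝ} (hV : ∀ s u z, 0 ≤ V s u z) (hV1 : ∀ s u, ∑ z, V s u z = 1)
    (T : 𝒮 → 𝒰 → 𝒵 → Prop)
    (hγ : ∀ s z, ∑ u, Q u * (if T s u z then 1 else 0) ≤ γ) (hγ0 : 0 ≤ γ)
    (h : 𝒮 → I) (s : 𝒮) (l : L) :
    iidExp Q (fun c : I × J × L → 𝒰 =>
        ∑ j : J, ∑ l' ∈ univ.erase l, ∑ k : J,
          if A s (c (h s, j, l)) then
            ∑ z, V s (c (h s, j, l)) z * (if T s (c (h s, k, l')) z then 1 else 0) else 0)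
      ≤ Fintype.card J * α * (Fintype.card J * Fintype.card L * γ) := by
  have hQA : ∑ u, Q u * (if A s u then 1 else 0) ≤ α := by
    calc ∑ u, Q u * (if A s u then 1 else 0) ≤ ∑ u, α * κ s u := by
          refine Finset.sum_le_sum fun u _ => ?_
          split_ifs with hu
          · simpa using hA s u hu
          · simpa using mul_nonneg hα (hκ s u)
      _ = α := by rw [← Finset.mul_sum, hκ1, mul_one]
  have hterm : ∀ (j : J), ∀ l' ∈ univ.erase l, ∀ k : J,
      iidExp Q (fun c : I × J × L → 𝒰 => if A s (c (h s, j, l)) then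
            ∑ z, V s (c (h s, j, l)) z * (if T s (c (h s, k, l')) z then 1 else 0) else 0)
        ≤ α * γ := by
    intro j l' hl' k
    -- With $l'\ne l$ the two entries are always distinct, hence independent, so no collision term
    -- arises for Eve.
    have hne : (h s, j, l) ≠ (h s, k, l') := by
      have := Finset.ne_of_mem_erase hl'
      simp [this.symm]
    rw [iidExp_apply_apply hQ1 (fun u u' => if A s u then
            ∑ z, V s u z * (if T s u' z then 1 else 0) else 0) hne]
    calc _ = ∑ u, Q u * (if A s u then 1 else 0) *
        ∑ z, V s u z * ∑ u', Q u' * (if T s u' z then 1 else 0) := by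
          simp only [Finset.mul_sum]
          refine Finset.sum_congr rfl fun u _ => ?_
          conv_rhs => rw [Finset.sum_comm]
          refine Finset.sum_congr rfl fun u' _ => ?_
          split_ifs
          · rw [Finset.mul_sum]
            exact Finset.sum_congr rfl fun y _ => by ring
          · simp
      _ ≤ ∑ u, Q u * (if A s u then 1 else 0) * γ := by
          refine Finset.sum_le_sum fun u _ => mul_le_mul_of_nonneg_left ?_
            (mul_nonneg (hQ u) (by split_ifs <;> simp))
          calc _ ≤ ∑ z, V s u z * γ :=
                Finset.sum_le_sum fun z _ => mul_le_mul_of_nonneg_left (hγ s z) (hV _ _ _)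
            _ = γ := by rw [← Finset.sum_mul, hV1, one_mul]
      _ ≤ α * γ := by
          rw [← Finset.sum_mul]
          exact mul_le_mul_of_nonneg_right hQA hγ0
  calc _ ≤ ∑ _j : J, ∑ _l' ∈ univ.erase l, ∑ _k : J, α * γ := by
        rw [iidExp_sum]
        refine Finset.sum_le_sum fun j _ => ?_
        rw [iidExp_sum]
        refine Finset.sum_le_sum fun l' hl' => ?_
        rw [iidExp_sum]
        exact Finset.sum_le_sum fun k _ => hterm j l' hl' k
    _ ≤ ∑ _j : J, ∑ _l' : L, ∑ _k : J, α * γ := by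
        refine Finset.sum_le_sum fun j _ => Finset.sum_le_sum_of_subset_of_nonneg
          (Finset.erase_subset _ _) fun s' _ _ => ?_
        positivity
    _ = _ := by
        simp
        ring


open Classical in
/-- **One-shot random coding.** There are codewords `w s l` (for the state `s` and the local
randomness `l`) and lists `ΛY` of states and `ΛZ` of indices such that the encoder rarely fails and
both lists are short on average. -/
theorem exists_code {p : 𝒮 → ℝ} (hp : ∀ s, 0 ≤ p s) (hp1 : ∑ s, p s = 1)
    {Q : 𝒰 → ℝ} (hQ : ∀ u, 0 ≤ Q u) (hQ1 : ∑ u, Q u = 1)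
    {κ : 𝒮 → 𝒰 → ℝ} (hκ : ∀ s u, 0 ≤ κ s u) (hκ1 : ∀ s, ∑ u, κ s u = 1)
    {VY : 𝒮 → 𝒰 → 𝒴 → ℝ} (hVY : ∀ s u y, 0 ≤ VY s u y) (hVY1 : ∀ s u, ∑ y, VY s u y = 1)
    {VZ : 𝒮 → 𝒰 → 𝒵 → ℝ} (hVZ : ∀ s u z, 0 ≤ VZ s u z) (hVZ1 : ∀ s u, ∑ z, VZ s u z = 1)
    (A : 𝒮 → 𝒰 → Prop) (TY : 𝒮 → 𝒰 → 𝒴 → Prop) (TZ : 𝒮 → 𝒰 → 𝒵 → Prop)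
    {α₁ α₂ βa βb γ KY KZ : ℝ} (hα₁ : 0 < α₁) (hα₂ : 0 ≤ α₂) (hβa : 0 ≤ βa) (hβb : 0 ≤ βb)
    (hγ : 0 ≤ γ) (hKY : 0 < KY) (hKZ : 0 < KZ)
    (hA₁ : ∀ s u, A s u → κ s u ≤ α₁ * Q u) (hA₂ : ∀ s u, A s u → Q u ≤ α₂ * κ s u)
    (hTYa : ∀ y, ∑ s, ∑ u, Q u * (if TY s u y then 1 else 0) ≤ βa)
    (hTYb : ∀ u y, ∑ s, (if TY s u y then (1 : ℝ) else 0) ≤ βb)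
    (hTZ : ∀ s z, ∑ u, Q u * (if TZ s u z then 1 else 0) ≤ γ)
    (I J L : Type*) [Fintype I] [Fintype J] [Fintype L] [Nonempty I] [Nonempty J] [Nonempty L]
    [DecidableEq L] :
    ∃ (w : 𝒮 → L → 𝒰) (ΛY : 𝒴 → Finset 𝒮) (ΛZ : 𝒮 → 𝒵 → Finset L),
      (∀ s l y, TY s (w s l) y → s ∈ ΛY y) ∧ (∀ s l z, TZ s (w s l) z → l ∈ ΛZ s z) ∧
      (∑ s, ∑ l, p s * (Fintype.card L : ℝ)⁻¹ * if A s (w s l) then 0 else 1)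
        + (∑ s, ∑ l, p s * (Fintype.card L : ℝ)⁻¹ * if A s (w s l) then
            ∑ y, VY s (w s l) y * (((ΛY y).erase s).card : ℝ) else 0) / KY
        + (∑ s, ∑ l, p s * (Fintype.card L : ℝ)⁻¹ * if A s (w s l) then
            ∑ z, VZ s (w s l) z * (((ΛZ s z).erase l).card : ℝ) else 0) / KZ
      ≤ (∑ s, p s * ∑ u, κ s u * if A s u then 0 else 1) + Real.exp (-(Fintype.card J / α₁))
        + Fintype.card J * α₂ * (Fintype.card J * Fintype.card L * βa + βb / Fintype.card I) / KY
        + Fintype.card J * α₂ * (Fintype.card J * Fintype.card L * γ) / KZ := by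
  have hI : (0 : ℝ) < Fintype.card I := by exact_mod_cast Fintype.card_pos
  have hL : (0 : ℝ) < Fintype.card L := by exact_mod_cast Fintype.card_pos
  have hunif : ∑ _i : I, (Fintype.card I : ℝ)⁻¹ = 1 := by simp
  set W : (𝒮 → I) → (I × J × L → 𝒰) → 𝒮 → L → 𝒰 := fun h c =>
    selectWord A (fun s j l => c (h s, j, l)) with hW
  set ΛY : (𝒮 → I) → (I × J × L → 𝒰) → 𝒴 → Finset 𝒮 := fun h c y =>
    univ.filter fun s => ∃ k : J × L, TY s (c (h s, k)) y with hΛY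
  set ΛZ : (𝒮 → I) → (I × J × L → 𝒰) → 𝒮 → 𝒵 → Finset L := fun h c s z =>
    univ.filter fun l => ∃ j : J, TZ s (c (h s, j, l)) z with hΛZ
  set B1 := (∑ s, p s * ∑ u, κ s u * if A s u then 0 else 1) + Real.exp (-(Fintype.card J / α₁))
    with hB1
  set B2 := Fintype.card J * α₂ * (Fintype.card J * Fintype.card L * βa + βb / Fintype.card I)
    with hB2
  set B3 := Fintype.card J * α₂ * (Fintype.card J * Fintype.card L * γ) with hB3
  set π : 𝒮 → ℝ := fun s => p s * (Fintype.card L : ℝ)⁻¹ with hπ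
  have hπ0 : ∀ s, 0 ≤ π s := fun s => mul_nonneg (hp s) (by positivity)
  have hπ1 : ∀ b : ℝ, ∑ s, ∑ _l : L, π s * b = b := by
    intro b
    simp only [hπ, Finset.sum_const, Finset.card_univ, nsmul_eq_mul]
    calc _ = ∑ s, p s * b := Finset.sum_congr rfl fun s _ => by field_simp
      _ = b := by rw [← Finset.sum_mul, hp1, one_mul]
  set F1 : (𝒮 → I) → (I × J × L → 𝒰) → ℝ := fun h c =>
    ∑ s, ∑ l, π s * if A s (W h c s l) then 0 else 1 with hF1
  set F2 : (𝒮 → I) → (I × J × L → 𝒰) → ℝ := fun h c =>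
    ∑ s, ∑ l, π s * if A s (W h c s l) then
      ∑ y, VY s (W h c s l) y * (((ΛY h c y).erase s).card : ℝ) else 0 with hF2
  set F3 : (𝒮 → I) → (I × J × L → 𝒰) → ℝ := fun h c =>
    ∑ s, ∑ l, π s * if A s (W h c s l) then
      ∑ z, VZ s (W h c s l) z * (((ΛZ h c s z).erase l).card : ℝ) else 0 with hF3
  set E : ((𝒮 → I) → (I × J × L → 𝒰) → ℝ) → ℝ := fun F =>
    iidExp (fun _ : I => (Fintype.card I : ℝ)⁻¹) (fun h => iidExp Q (F h)) with hE
  have hE_mono : ∀ F G : (𝒮 → I) → (I × J × L → 𝒰) → ℝ, (∀ h c, F h c ≤ G h c) → E F ≤ E G :=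
    fun F G h => iidExp_mono (fun _ => by positivity) fun x => iidExp_mono hQ (h x)
  have hE_sum : ∀ F : 𝒮 → L → (𝒮 → I) → (I × J × L → 𝒰) → ℝ,
      E (fun h c => ∑ s, ∑ l, π s * F s l h c) = ∑ s, ∑ l, π s * E (F s l) := by
    intro F
    simp only [hE, iidExp_sum, iidExp_const_mul]
  have h1 : E F1 ≤ B1 := by
    calc E F1 = ∑ s, ∑ l, π s * E (fun h c => if A s (W h c s l) then 0 else 1) := hE_sum _
      _ ≤ ∑ s, ∑ _l : L, π s * ((∑ u, κ s u * if A s u then 0 else 1)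
            + Real.exp (-(Fintype.card J / α₁))) := by
          refine Finset.sum_le_sum fun s _ => Finset.sum_le_sum fun l _ =>
            mul_le_mul_of_nonneg_left ?_ (hπ0 s)
          refine (iidExp_mono (fun _ => by positivity) fun h =>
            iidExp_fail_le A hQ hQ1 hκ hκ1 hα₁ hA₁ h s l).trans_eq (iidExp_const hunif _)
      _ = B1 := by
          simp only [hπ, Finset.sum_const, Finset.card_univ, nsmul_eq_mul]
          calc _ = ∑ s, p s * ((∑ u, κ s u * if A s u then 0 else 1)
            + Real.exp (-(Fintype.card J / α₁))) := Finset.sum_congr rfl fun s _ => by field_simp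
            _ = B1 := by
              simp only [mul_add, Finset.sum_add_distrib, ← Finset.sum_mul, hp1, one_mul, hB1]
  have h2 : E F2 ≤ B2 := by
    rw [← hπ1 B2]
    refine (hE_sum _).trans_le ?_
    refine Finset.sum_le_sum fun s _ => Finset.sum_le_sum fun l _ =>
      mul_le_mul_of_nonneg_left ?_ (hπ0 s)
    refine (hE_mono _ _ fun h c => ?_).trans
      (iidExp_falseStates_le A hQ hQ1 hκ hκ1 hα₂ hA₂ hVY hVY1 TY hTYa hTYb hβa hβb s l)
    refine (selectWord_sum_le A (fun s j l => c (h s, j, l)) s l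
      (fun u => ∑ y, VY s u y * (((ΛY h c y).erase s).card : ℝ))
      (fun u => Finset.sum_nonneg fun y _ => mul_nonneg (hVY _ _ _) (Nat.cast_nonneg _))).trans ?_
    refine Finset.sum_le_sum fun j _ => ?_
    split_ifs
    · calc _ ≤ ∑ y, ∑ s' ∈ univ.erase s, ∑ k : J × L,
            VY s (c (h s, j, l)) y * (if TY s' (c (h s', k)) y then 1 else 0) := by
            refine Finset.sum_le_sum fun y _ => ?_
            simp only [← Finset.mul_sum]
            refine mul_le_mul_of_nonneg_left ?_ (hVY _ _ _)
            rw [hΛY, ← Finset.filter_erase]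
            exact card_filter_exists_le _ _
        _ = _ := by
            rw [Finset.sum_comm]
            exact Finset.sum_congr rfl fun s' _ => Finset.sum_comm
    · simp
  have h3 : E F3 ≤ B3 := by
    rw [← hπ1 B3]
    refine (hE_sum _).trans_le ?_
    refine Finset.sum_le_sum fun s _ => Finset.sum_le_sum fun l _ =>
      mul_le_mul_of_nonneg_left ?_ (hπ0 s)
    refine (iidExp_mono (fun _ => by positivity) fun h => (iidExp_mono hQ fun c => ?_).trans
      (iidExp_falseIndices_le A hQ hQ1 hκ hκ1 hα₂ hA₂ hVZ hVZ1 TZ hTZ hγ h s l)).trans_eq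
        (iidExp_const hunif _)
    refine (selectWord_sum_le A (fun s j l => c (h s, j, l)) s l
      (fun u => ∑ z, VZ s u z * (((ΛZ h c s z).erase l).card : ℝ))
      (fun u => Finset.sum_nonneg fun y _ => mul_nonneg (hVZ _ _ _) (Nat.cast_nonneg _))).trans ?_
    refine Finset.sum_le_sum fun j _ => ?_
    split_ifs
    · calc _ ≤ ∑ z, ∑ l' ∈ univ.erase l, ∑ k : J,
            VZ s (c (h s, j, l)) z * (if TZ s (c (h s, k, l')) z then 1 else 0) := by
            refine Finset.sum_le_sum fun z _ => ?_
            simp only [← Finset.mul_sum]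
            refine mul_le_mul_of_nonneg_left ?_ (hVZ _ _ _)
            rw [hΛZ, ← Finset.filter_erase]
            exact card_filter_exists_le _ _
        _ = _ := by
            rw [Finset.sum_comm]
            exact Finset.sum_congr rfl fun s' _ => Finset.sum_comm
    · simp
  have hEtot : E (fun h c => F1 h c + F2 h c / KY + F3 h c / KZ) ≤ B1 + B2 / KY + B3 / KZ := by
    have : E (fun h c => F1 h c + F2 h c / KY + F3 h c / KZ) = E F1 + E F2 / KY + E F3 / KZ := by
      simp only [hE, div_eq_inv_mul, iidExp_add, iidExp_const_mul]
    rw [this]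
    gcongr
  -- The three errors are averaged as one sum, so a single hash and then a single codebook are good
  -- for Bob and Eve simultaneously.
  obtain ⟨h, hh⟩ := exists_le_iidExp (fun _ : I => by positivity) hunif
    (fun h => iidExp Q (fun c => F1 h c + F2 h c / KY + F3 h c / KZ))
  obtain ⟨c, hc⟩ := exists_le_iidExp hQ hQ1 (fun c => F1 h c + F2 h c / KY + F3 h c / KZ)
  refine ⟨W h c, ΛY h c, ΛZ h c, fun s l y hT => ?_, fun s l z hT => ?_,
    hc.trans (hh.trans hEtot)⟩
  · obtain ⟨j, hj⟩ := exists_selectWord_eq A (fun s j l => c (h s, j, l)) s l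
    simp only [hW, hj] at hT
    simp only [hΛY, Finset.mem_filter, mem_univ, true_and]
    exact ⟨(j, l), hT⟩
  · obtain ⟨j, hj⟩ := exists_selectWord_eq A (fun s j l => c (h s, j, l)) s l
    simp only [hW, hj] at hT
    simp only [hΛZ, Finset.mem_filter, mem_univ, true_and]
    exact ⟨j, hT⟩

end RandomCoding

/-! ### Equivocation and leakage of a fixed code -/

section CodeEntropy

variable {𝒮 𝒰 𝒴 L : Type*} [Fintype 𝒮] [Fintype 𝒴] [Fintype L]

/-- The joint law of the state, the local randomness and the channel output, when `w s l` is the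
codeword used and `V` is the channel. -/
noncomputable def codeLaw (p : 𝒮 → ℝ) (w : 𝒮 → L → 𝒰) (V : 𝒮 → 𝒰 → 𝒴 → ℝ) : 𝒮 × L × 𝒴 → ℝ :=
  fun x => p x.1 * (Fintype.card L : ℝ)⁻¹ * V x.1 (w x.1 x.2.1) x.2.2

variable {p : 𝒮 → ℝ} {w : 𝒮 → L → 𝒰} {V : 𝒮 → 𝒰 → 𝒴 → ℝ}

lemma codeLaw_nonneg (hp : ∀ s, 0 ≤ p s) (hV : ∀ s u y, 0 ≤ V s u y) (x : 𝒮 × L × 𝒴) :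
    0 ≤ codeLaw p w V x :=
  mul_nonneg (mul_nonneg (hp _) (by positivity)) (hV _ _ _)

lemma sum_codeLaw_mul (F : 𝒮 → L → 𝒴 → ℝ) :
    ∑ x, codeLaw p w V x * F x.1 x.2.1 x.2.2 =
      ∑ s, ∑ l, p s * (Fintype.card L : ℝ)⁻¹ * ∑ y, V s (w s l) y * F s l y := by
  simp only [Fintype.sum_prod_type, codeLaw, Finset.mul_sum, mul_assoc]

lemma sum_sum_div_card [Nonempty L] (hp1 : ∑ s, p s = 1) (b : ℝ) :
    ∑ s, ∑ _l : L, p s * (Fintype.card L : ℝ)⁻¹ * b = b := by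
  have hL : (0 : ℝ) < Fintype.card L := by exact_mod_cast Fintype.card_pos
  simp only [Finset.sum_const, Finset.card_univ, nsmul_eq_mul]
  calc _ = ∑ s, p s * b := Finset.sum_congr rfl fun s _ => by field_simp
    _ = b := by rw [← Finset.sum_mul, hp1, one_mul]

lemma sum_codeLaw [Nonempty L] (hp1 : ∑ s, p s = 1) (hV1 : ∀ s u, ∑ y, V s u y = 1) :
    ∑ x, codeLaw p w V x = 1 := by
  have := sum_codeLaw_mul (p := p) (w := w) (V := V) (fun _ _ _ => 1)
  simp only [mul_one, hV1] at this
  rw [this, ← sum_sum_div_card (L := L) hp1 1]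
  simp

lemma law_codeLaw_state_index (hV1 : ∀ s u, ∑ y, V s u y = 1) (s : 𝒮) (l : L) :
    law (codeLaw p w V) (fun x => (x.1, x.2.1)) (s, l) = p s * (Fintype.card L : ℝ)⁻¹ := by
  classical
  rw [law_eq_sum, sum_codeLaw_mul (fun s' l' _ => if (s', l') = (s, l) then 1 else 0)]
  simp only [← Finset.sum_mul, hV1, one_mul, Prod.mk.injEq, ite_and]
  simp

lemma law_codeLaw_state [Nonempty L] (hV1 : ∀ s u, ∑ y, V s u y = 1) (s : 𝒮) :
    law (codeLaw p w V) (fun x => x.1) s = p s := by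
  classical
  have hL : (0 : ℝ) < Fintype.card L := by exact_mod_cast Fintype.card_pos
  rw [law_eq_sum, sum_codeLaw_mul (fun s' _ _ => if s' = s then 1 else 0)]
  simp only [← Finset.sum_mul, hV1, one_mul, Finset.sum_const]
  simp
  field_simp

-- Either the encoder fails, or it succeeds and then the output is atypical with conditional
-- probability at most $\eta$, since `hAT` holds for each pair in `A`.
open Classical in
lemma sum_codeLaw_not_le [Nonempty L] (hp : ∀ s, 0 ≤ p s) (hp1 : ∑ s, p s = 1)
    (hV1 : ∀ s u, ∑ y, V s u y = 1) (A : 𝒮 → 𝒰 → Prop)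
    (T : 𝒮 → 𝒰 → 𝒴 → Prop) {η : ℝ} (hη : 0 ≤ η)
    (hAT : ∀ s u, A s u → ∑ y, V s u y * (if T s u y then 0 else 1) ≤ η) :
    ∑ x, codeLaw p w V x *
        (if A x.1 (w x.1 x.2.1) ∧ T x.1 (w x.1 x.2.1) x.2.2 then 0 else 1)
      ≤ (∑ s, ∑ l, p s * (Fintype.card L : ℝ)⁻¹ * if A s (w s l) then 0 else 1) + η := by
  rw [sum_codeLaw_mul (fun s l y => if A s (w s l) ∧ T s (w s l) y then 0 else 1),
    ← sum_sum_div_card (L := L) hp1 η]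
  simp only [← Finset.sum_add_distrib, ← mul_add]
  refine Finset.sum_le_sum fun s _ => Finset.sum_le_sum fun l _ =>
    mul_le_mul_of_nonneg_left ?_ (mul_nonneg (hp s) (by positivity))
  by_cases h : A s (w s l)
  · simpa [h] using hAT s _ h
  · simp [h, hV1, hη]

-- The additive $1$ pays for the true value `d s l`, which the random coding bound leaves out of the
-- list.
open Classical in
lemma sum_codeLaw_card_le {D : Type*} [DecidableEq D] [Nonempty L] (hp : ∀ s, 0 ≤ p s)
    (hp1 : ∑ s, p s = 1) (hV : ∀ s u y, 0 ≤ V s u y) (hV1 : ∀ s u, ∑ y, V s u y = 1)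
    (A : 𝒮 → 𝒰 → Prop) (T : 𝒮 → 𝒰 → 𝒴 → Prop) (Λ : 𝒮 → 𝒴 → Finset D) (d : 𝒮 → L → D) :
    ∑ x, codeLaw p w V x * (if A x.1 (w x.1 x.2.1) ∧ T x.1 (w x.1 x.2.1) x.2.2 then
        ((Λ x.1 x.2.2).card : ℝ) else 0)
      ≤ 1 + ∑ s, ∑ l, p s * (Fintype.card L : ℝ)⁻¹ * if A s (w s l) then
        ∑ y, V s (w s l) y * (((Λ s y).erase (d s l)).card : ℝ) else 0 := by
  rw [sum_codeLaw_mul (fun s l y => if A s (w s l) ∧ T s (w s l) y then ((Λ s y).card : ℝ) else 0),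
    ← sum_sum_div_card (L := L) hp1 1]
  simp only [← Finset.sum_add_distrib, ← mul_add]
  refine Finset.sum_le_sum fun s _ => Finset.sum_le_sum fun l _ =>
    mul_le_mul_of_nonneg_left ?_ (mul_nonneg (hp s) (by positivity))
  by_cases h : A s (w s l)
  · rw [if_pos h, ← hV1 s (w s l), ← Finset.sum_add_distrib]
    refine Finset.sum_le_sum fun y _ => ?_
    rw [← mul_one_add]
    refine mul_le_mul_of_nonneg_left ?_ (hV _ _ _)
    have h1 : ((Λ s y).card : ℝ) ≤ 1 + ((Λ s y).erase (d s l)).card := by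
      have := Finset.pred_card_le_card_erase (s := Λ s y) (a := d s l)
      have h2 : (Λ s y).card ≤ 1 + ((Λ s y).erase (d s l)).card := by omega
      exact_mod_cast h2
    split_ifs
    · exact h1
    · positivity
  · simp [h]

open Classical in
/-- The uncertainty of Bob about the state. -/
theorem natCondEntropy_state_le [DecidableEq 𝒮] [Nonempty 𝒮] [Nonempty L] (hp : ∀ s, 0 ≤ p s)
    (hp1 : ∑ s, p s = 1) (hV : ∀ s u y, 0 ≤ V s u y) (hV1 : ∀ s u, ∑ y, V s u y = 1)
    (A : 𝒮 → 𝒰 → Prop) (T : 𝒮 → 𝒰 → 𝒴 → Prop) {η : ℝ} (hη : 0 ≤ η)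
    (hAT : ∀ s u, A s u → ∑ y, V s u y * (if T s u y then 0 else 1) ≤ η)
    (Λ : 𝒴 → Finset 𝒮) (hΛ : ∀ s l y, T s (w s l) y → s ∈ Λ y) {K : ℝ} (hK : 1 ≤ K) :
    natEntropy (codeLaw p w V) (fun x => (x.1, x.2.2))
        - natEntropy (codeLaw p w V) (fun x => x.2.2)
      ≤ Real.log 2 + Real.log K
        + ((∑ s, ∑ l, p s * (Fintype.card L : ℝ)⁻¹ * if A s (w s l) then 0 else 1) + η)
          * Real.log (Fintype.card 𝒮)
        + (1 + ∑ s, ∑ l, p s * (Fintype.card L : ℝ)⁻¹ * if A s (w s l) then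
          ∑ y, V s (w s l) y * (((Λ y).erase s).card : ℝ) else 0) / K := by
  have hlog : 0 ≤ Real.log (Fintype.card 𝒮) :=
    Real.log_nonneg (by exact_mod_cast Fintype.card_pos)
  refine (natCondEntropy_le_of_list (codeLaw_nonneg hp hV) (sum_codeLaw hp1 hV1)
    (fun x => x.1) (fun x => x.2.2) (fun x => A x.1 (w x.1 x.2.1) ∧ T x.1 (w x.1 x.2.1) x.2.2)
    Λ (fun x hx => hΛ _ _ _ hx.2) hK).trans ?_
  have h1 := sum_codeLaw_not_le (w := w) hp hp1 hV1 A T hη hAT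
  have h2 := sum_codeLaw_card_le (w := w) hp hp1 hV hV1 A T (fun _ => Λ) (fun s _ => s)
  gcongr

open Classical in
/-- The leakage to Eve, in terms of her uncertainty about the local randomness. -/
theorem natMutualInfo_state_le [Nonempty 𝒴] [Nonempty L] (hp : ∀ s, 0 ≤ p s)
    (hp1 : ∑ s, p s = 1) (hV : ∀ s u y, 0 ≤ V s u y) (hV1 : ∀ s u, ∑ y, V s u y = 1)
    (A : 𝒮 → 𝒰 → Prop) (T : 𝒮 → 𝒰 → 𝒴 → Prop) {η : ℝ} (hη : 0 ≤ η)
    (hAT : ∀ s u, A s u → ∑ y, V s u y * (if T s u y then 0 else 1) ≤ η)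
    {q : 𝒴 → ℝ} (hq : ∀ y, 0 ≤ q y) (hq1 : ∑ y, q y ≤ 1) {ζ : ℝ} (hζ : 1 ≤ ζ)
    (hT : ∀ s u y, T s u y → V s u y ≤ ζ * q y) :
    natEntropy (codeLaw p w V) (fun x => x.1) + natEntropy (codeLaw p w V) (fun x => x.2.2)
        - natEntropy (codeLaw p w V) (fun x => (x.1, x.2.2))
      ≤ Real.log 2 + Real.log ζ
        + ((∑ s, ∑ l, p s * (Fintype.card L : ℝ)⁻¹ * if A s (w s l) then 0 else 1) + η)
          * Real.log (Fintype.card 𝒴)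
        - Real.log (Fintype.card L)
        + (natEntropy (codeLaw p w V) (fun x => (x.2.1, (x.1, x.2.2)))
          - natEntropy (codeLaw p w V) (fun x => (x.1, x.2.2))) := by
  have hL : (0 : ℝ) < Fintype.card L := by exact_mod_cast Fintype.card_pos
  have hlog : 0 ≤ Real.log (Fintype.card 𝒴) :=
    Real.log_nonneg (by exact_mod_cast Fintype.card_pos)
  set P := codeLaw p w V with hP
  have hP0 : ∀ x, 0 ≤ P x := codeLaw_nonneg hp hV
  have hP1 : ∑ x, P x = 1 := sum_codeLaw hp1 hV1
  -- The local randomness is uniform and independent of the state: $H(S,L)=H(S)+\log|L|$.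
  have h1 : natEntropy P (fun x => (x.1, x.2.1))
      = natEntropy P (fun x => x.1) + Real.log (Fintype.card L) := by
    have : natEntropy P (fun x => (x.1, x.2.1))
        = ∑ x, (P x * -Real.log (law P (fun x => x.1) x.1)
          + P x * Real.log (Fintype.card L)) := by
      refine Finset.sum_congr rfl fun x _ => ?_
      rcases (hP0 x).eq_or_lt with h | h
      · simp [← h]
      have hpx : 0 < p x.1 := by
        refine (hp x.1).lt_of_ne fun h0 => h.ne' ?_
        simp [hP, codeLaw, ← h0]
      rw [law_codeLaw_state_index hV1, law_codeLaw_state hV1,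
        Real.log_mul hpx.ne' (by positivity), Real.log_inv]
      ring
    rw [this, Finset.sum_add_distrib, ← Finset.sum_mul, hP1, one_mul, natEntropy]
  have h2 : natEntropy P (fun x => ((x.1, x.2.1), x.2.2))
      = natEntropy P (fun x => (x.2.1, (x.1, x.2.2))) :=
    natEntropy_comp_equiv P (fun x => (x.2.1, (x.1, x.2.2)))
      ⟨fun t => ((t.2.1, t.1), t.2.2), fun t => (t.1.2, (t.1.1, t.2)), fun _ => rfl, fun _ => rfl⟩
  -- This bounds $I(S,L;Z)$. Given $(s,l)$ the codeword is determined, so the likelihood ratio is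
  -- that of the channel `V` against `q`. The chain rule then yields
  -- $I(S;Z)=I(S,L;Z)-\log|L|+H(L|S,Z)$.
  have h3 := natMutualInfo_le_of_density hP0 hP1 (fun x => (x.1, x.2.1)) (fun x => x.2.2)
    (fun x => A x.1 (w x.1 x.2.1) ∧ T x.1 (w x.1 x.2.1) x.2.2) q hq hq1 hζ (by
      rintro ⟨s, l, y⟩ ⟨-, hx⟩
      dsimp only
      rw [law_codeLaw_state_index hV1, law_eq_sum, Finset.sum_eq_single (s, l, y)]
      · have := hT _ _ _ hx
        have h4 : 0 ≤ p s * (Fintype.card L : ℝ)⁻¹ := mul_nonneg (hp s) (by positivity)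
        simp only [hP, codeLaw, if_true, mul_one]
        calc _ ≤ p s * (Fintype.card L : ℝ)⁻¹ * (ζ * q y) := mul_le_mul_of_nonneg_left this h4
          _ = _ := by ring
      · rintro ⟨s', l', y'⟩ - hne
        simp only [Prod.mk.injEq, ne_eq] at hne ⊢
        rw [if_neg (by tauto), mul_zero]
      · simp)
  have h4 := sum_codeLaw_not_le (w := w) hp hp1 hV1 A T hη hAT
  have h5 := mul_le_mul_of_nonneg_right h4 hlog
  simp only [← hP] at h5
  linarith

open Classical in
/-- The uncertainty of Eve, who is told the state, about the local randomness. -/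
theorem natCondEntropy_index_le [DecidableEq L] [Nonempty L] (hp : ∀ s, 0 ≤ p s)
    (hp1 : ∑ s, p s = 1) (hV : ∀ s u y, 0 ≤ V s u y) (hV1 : ∀ s u, ∑ y, V s u y = 1)
    (A : 𝒮 → 𝒰 → Prop) (T : 𝒮 → 𝒰 → 𝒴 → Prop) {η : ℝ} (hη : 0 ≤ η)
    (hAT : ∀ s u, A s u → ∑ y, V s u y * (if T s u y then 0 else 1) ≤ η)
    (Λ : 𝒮 → 𝒴 → Finset L) (hΛ : ∀ s l y, T s (w s l) y → l ∈ Λ s y) {K : ℝ} (hK : 1 ≤ K) :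
    natEntropy (codeLaw p w V) (fun x => (x.2.1, (x.1, x.2.2)))
        - natEntropy (codeLaw p w V) (fun x => (x.1, x.2.2))
      ≤ Real.log 2 + Real.log K
        + ((∑ s, ∑ l, p s * (Fintype.card L : ℝ)⁻¹ * if A s (w s l) then 0 else 1) + η)
          * Real.log (Fintype.card L)
        + (1 + ∑ s, ∑ l, p s * (Fintype.card L : ℝ)⁻¹ * if A s (w s l) then
          ∑ y, V s (w s l) y * (((Λ s y).erase l).card : ℝ) else 0) / K := by
  have hlog : 0 ≤ Real.log (Fintype.card L) :=
    Real.log_nonneg (by exact_mod_cast Fintype.card_pos)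
  refine (natCondEntropy_le_of_list (codeLaw_nonneg hp hV) (sum_codeLaw hp1 hV1)
    (fun x => x.2.1) (fun x => (x.1, x.2.2))
    (fun x => A x.1 (w x.1 x.2.1) ∧ T x.1 (w x.1 x.2.1) x.2.2)
    (fun b => Λ b.1 b.2) (fun x hx => hΛ _ _ _ hx.2) hK).trans ?_
  have h1 := sum_codeLaw_not_le (w := w) hp hp1 hV1 A T hη hAT
  have h2 := sum_codeLaw_card_le (w := w) hp hp1 hV hV1 A T Λ (fun _ l => l)
  gcongr

/-- Gibbs with the uniform guess. For the index this cancels $-\log|L|$ in the leakage and is the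
bound that suffices when $I(U;Z)\le I(U;S)$. -/
theorem natCondEntropy_le_log_card {Ω A B : Type*} [Fintype Ω] [Fintype A] [Fintype B] [Nonempty A]
    {P : Ω → ℝ} (hP : ∀ ω, 0 ≤ P ω) (hP1 : ∑ ω, P ω = 1) (f : Ω → A) (g : Ω → B) :
    natEntropy P (fun ω => (f ω, g ω)) - natEntropy P g ≤ Real.log (Fintype.card A) := by
  have hA : (0 : ℝ) < Fintype.card A := by exact_mod_cast Fintype.card_pos
  refine (natCondEntropy_le_crossEntropy hP f g (fun _ _ => (Fintype.card A : ℝ)⁻¹)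
    (fun _ _ => by positivity) (fun _ => by simp) (fun _ _ => by positivity)).trans_eq ?_
  rw [← Finset.sum_mul, hP1, Real.log_inv, neg_neg, one_mul]

end CodeEntropy

/-! ### Typical sequences and the weak law of large numbers -/

section Typicality

variable {α : Type*} [Fintype α]

-- Chebyshev's inequality, one-sided: the indicator is dominated by the squared normalized
-- deviation, and the off-diagonal terms vanish because the summands are centered and independent.
open Classical in
lemma iidExp_deviation_le {p : α → ℝ} (hp : ∀ x, 0 ≤ p x) (hp1 : ∑ x, p x = 1) (g : α → ℝ)
    {δ : ℝ} (hδ : 0 < δ) {n : ℕ} (hn : 0 < n) :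
    iidExp p (fun t : Fin n → α =>
        if ∑ i, g (t i) ≤ n * (∑ x, p x * g x + δ) then (0 : ℝ) else 1)
      ≤ (∑ x, p x * (g x - ∑ x, p x * g x) ^ 2) / (n * δ ^ 2) := by
  set m := ∑ x, p x * g x with hm
  have hn' : (0 : ℝ) < n := by exact_mod_cast hn
  have h1 : ∀ t : Fin n → α, (if ∑ i, g (t i) ≤ n * (m + δ) then (0 : ℝ) else 1)
      ≤ (n * δ)⁻¹ ^ 2 * ∑ i, ∑ j, (g (t i) - m) * (g (t j) - m) := by
    intro t
    have h2 : ∑ i, ∑ j, (g (t i) - m) * (g (t j) - m) = (∑ i, (g (t i) - m)) ^ 2 := by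
      rw [sq, Finset.sum_mul_sum]
    rw [h2, ← mul_pow]
    split_ifs with h
    · positivity
    · have h3 : n * δ ≤ ∑ i, (g (t i) - m) := by
        rw [Finset.sum_sub_distrib]
        simp only [Finset.sum_const, Finset.card_univ, Fintype.card_fin, nsmul_eq_mul]
        linarith
      refine one_le_pow₀ ?_
      rw [← div_eq_inv_mul, le_div_iff₀ (by positivity)]
      linarith
  have hcentered : ∑ x, p x * (g x - m) = 0 := by
    simp [mul_sub, Finset.sum_sub_distrib, ← Finset.sum_mul, hp1, hm]
  refine (iidExp_mono hp h1).trans_eq ?_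
  rw [iidExp_const_mul, iidExp_sum]
  have h4 : ∀ i : Fin n, iidExp p (fun t => ∑ j, (g (t i) - m) * (g (t j) - m))
      = ∑ x, p x * (g x - m) ^ 2 := by
    intro i
    rw [iidExp_sum, Finset.sum_eq_single i]
    · rw [iidExp_apply hp1 (fun x => (g x - m) * (g x - m))]
      simp only [sq]
    · intro j _ hj
      rw [iidExp_apply_mul_apply hp1 (fun x => g x - m) (fun x => g x - m) hj.symm, hcentered,
        zero_mul]
    · simp
  simp only [h4, Finset.sum_const, Finset.card_univ, Fintype.card_fin, nsmul_eq_mul]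
  field_simp

/-- A sequence `t` of positive probability along which the log-likelihood ratio of `r₁` and `r₂` does
not exceed its expectation by more than `δ` per letter. -/
def IsTypical (p r₁ r₂ : α → ℝ) (δ : ℝ) {n : ℕ} (t : Fin n → α) : Prop :=
  0 < ∏ i, p (t i) ∧
    ∏ i, r₁ (t i) ≤ Real.exp (n * (∑ x, p x * Real.log (r₁ x / r₂ x) + δ)) * ∏ i, r₂ (t i)

open Classical in
/-- **Asymptotic equipartition.** -/
theorem tendsto_iidExp_atypical {p : α → ℝ} (hp : ∀ x, 0 ≤ p x) (hp1 : ∑ x, p x = 1)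
    {r₁ r₂ : α → ℝ} (hr₁ : ∀ x, 0 < p x → 0 < r₁ x) (hr₂ : ∀ x, 0 < p x → 0 < r₂ x)
    {δ : ℝ} (hδ : 0 < δ) :
    Tendsto (fun n : ℕ => iidExp p (fun t : Fin n → α =>
      if IsTypical p r₁ r₂ δ t then (0 : ℝ) else 1)) atTop (𝓝 0) := by
  set g : α → ℝ := fun x => Real.log (r₁ x / r₂ x) with hg
  set m := ∑ x, p x * g x with hm
  set v := ∑ x, p x * (g x - m) ^ 2 with hv
  have hlim : Tendsto (fun n : ℕ => v / (n * δ ^ 2)) atTop (𝓝 0) := by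
    have h1 : Tendsto (fun n : ℕ => (n : ℝ) * δ ^ 2) atTop atTop :=
      tendsto_natCast_atTop_atTop.atTop_mul_const (by positivity)
    exact h1.const_div_atTop v
  refine tendsto_of_tendsto_of_tendsto_of_le_of_le' tendsto_const_nhds hlim
    (Eventually.of_forall fun n => Finset.sum_nonneg fun t _ =>
      mul_nonneg (Finset.prod_nonneg fun i _ => hp _) (by beta_reduce; split_ifs <;> simp)) ?_
  filter_upwards [eventually_gt_atTop 0] with n hn
  refine le_trans ?_ (iidExp_deviation_le hp hp1 g hδ hn)
  refine Finset.sum_le_sum fun t _ => ?_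
  rcases (Finset.prod_nonneg fun i (_ : i ∈ univ) => hp (t i)).eq_or_lt with h0 | h0
  · simp [← h0]
  refine mul_le_mul_of_nonneg_left ?_ h0.le
  beta_reduce
  by_cases h : ∑ i, g (t i) ≤ n * (m + δ)
  · rw [if_pos h, if_pos]
    have hpos : ∀ i, 0 < p (t i) := fun i => (hp _).lt_of_ne fun h2 =>
      h0.ne (Finset.prod_eq_zero (mem_univ i) h2.symm).symm
    refine ⟨h0, ?_⟩
    -- Positive probability of the sequence makes every letter positive under `r₁` and `r₂`, so the
    -- ratio of products is the exponential of the sum of logarithms.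
    have h3 : ∏ i, r₁ (t i) = Real.exp (∑ i, g (t i)) * ∏ i, r₂ (t i) := by
      rw [Real.exp_sum, ← Finset.prod_mul_distrib]
      refine Finset.prod_congr rfl fun i _ => ?_
      have h4 := hr₁ _ (hpos i)
      have h5 := hr₂ _ (hpos i)
      rw [hg, Real.exp_log (by positivity)]
      field_simp
    rw [h3]
    exact mul_le_mul_of_nonneg_right (Real.exp_le_exp.2 h)
      (Finset.prod_nonneg fun i _ => (hr₂ _ (hpos i)).le)
  · rw [if_neg h]
    split_ifs <;> simp

lemma sum_arrow_prod {ι β γ : Type*} [Fintype ι] [DecidableEq ι] [Fintype β] [Fintype γ]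
    (F : (ι → β × γ) → ℝ) :
    ∑ t, F t = ∑ b : ι → β, ∑ c : ι → γ, F (fun i => (b i, c i)) := by
  rw [← (Equiv.arrowProdEquivProdArrow ι (fun _ => β) (fun _ => γ)).symm.sum_comp,
    Fintype.sum_prod_type]
  rfl

lemma sum_prod_eq_prod_sum {ι β : Type*} [Fintype ι] [DecidableEq ι] [Fintype β]
    (f : ι → β → ℝ) : ∑ b : ι → β, ∏ i, f i (b i) = ∏ i, ∑ x, f i x :=
  (Fintype.prod_sum f).symm

/-- If `Q x * b ≤ c * r x` on the set `T`, where `r` has total mass `b`, then `Q(T) ≤ c`. -/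
lemma sum_mul_indicator_le {β : Type*} [Fintype β] {Q r : β → ℝ} {b c : ℝ} (hr : ∀ x, 0 ≤ r x)
    (hsum : ∑ x, r x = b) (hc : 0 ≤ c) (T : β → Prop) [DecidablePred T]
    (hT : ∀ x, T x → 0 < r x ∧ Q x * b ≤ c * r x) :
    ∑ x, Q x * (if T x then 1 else 0) ≤ c := by
  have hb0 : 0 ≤ b := hsum ▸ Finset.sum_nonneg fun x _ => hr x
  rcases hb0.eq_or_lt with hb | hb
  -- When the total mass is zero the inequality with factor `b` says nothing. The requirement `0 < r
  -- x` on `T` then forces `T` to be empty, which is why typicality includes positive probability.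
  · have : ∀ x, ¬ T x := fun x hx => by
      have h1 := Finset.single_le_sum (fun x _ => hr x) (mem_univ x)
      rw [hsum, ← hb] at h1
      exact absurd (hT x hx).1 (not_lt.2 h1)
    simpa [this] using hc
  · refine le_of_mul_le_mul_right ?_ hb
    calc (∑ x, Q x * (if T x then 1 else 0)) * b ≤ ∑ x, c * r x := by
          rw [Finset.sum_mul]
          refine Finset.sum_le_sum fun x _ => ?_
          split_ifs with h
          · simpa using (hT x h).2
          · simpa using mul_nonneg hc (hr x)
      _ = c * b := by rw [← Finset.mul_sum, hsum]

end Typicality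

/-! ### Laws of the test channel and joint typicality -/

section Block

variable {S U Y : Type*} [Fintype S] [Fintype U] [Fintype Y]

/-- The joint law of the state, the auxiliary variable and a channel output. -/
def jointLaw (pS : S → ℝ) (κ : S → U → ℝ) (V : S → U → Y → ℝ) : S × U × Y → ℝ :=
  fun x => pS x.1 * κ x.1 x.2.1 * V x.1 x.2.1 x.2.2

/-- The joint law of the state and the auxiliary variable. -/
def stateAuxLaw (pS : S → ℝ) (κ : S → U → ℝ) : S × U → ℝ := fun x => pS x.1 * κ x.1 x.2

/-- The law of the auxiliary variable. -/
noncomputable def auxLaw (pS : S → ℝ) (κ : S → U → ℝ) (u : U) : ℝ := ∑ s, pS s * κ s u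

/-- The law of the channel output. -/
noncomputable def outLaw (pS : S → ℝ) (κ : S → U → ℝ) (V : S → U → Y → ℝ) (y : Y) : ℝ :=
  ∑ s, ∑ u, jointLaw pS κ V (s, u, y)

/-- The joint law of the auxiliary variable and the channel output. -/
noncomputable def auxOutLaw (pS : S → ℝ) (κ : S → U → ℝ) (V : S → U → Y → ℝ) (u : U) (y : Y) : ℝ :=
  ∑ s, jointLaw pS κ V (s, u, y)

variable {pS : S → ℝ} {κ : S → U → ℝ} {V : S → U → Y → ℝ}

lemma iidExp_stateAuxLaw {n : ℕ} (F : (Fin n → S × U) → ℝ) :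
    iidExp (stateAuxLaw pS κ) F = ∑ s : Fin n → S, (∏ i, pS (s i)) *
      ∑ u : Fin n → U, (∏ i, κ (s i) (u i)) * F (fun i => (s i, u i)) := by
  simp only [iidExp, sum_arrow_prod, stateAuxLaw, Finset.prod_mul_distrib, Finset.mul_sum,
    mul_assoc]

lemma iidExp_jointLaw {n : ℕ} (F : (Fin n → S × U × Y) → ℝ) :
    iidExp (jointLaw pS κ V) F = ∑ s : Fin n → S, (∏ i, pS (s i)) *
      ∑ u : Fin n → U, (∏ i, κ (s i) (u i)) *
        ∑ y : Fin n → Y, (∏ i, V (s i) (u i) (y i)) * F (fun i => (s i, u i, y i)) := by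
  simp only [iidExp, sum_arrow_prod, jointLaw, Finset.prod_mul_distrib, Finset.mul_sum, mul_assoc]

lemma sum_prod_auxOutLaw {n : ℕ} (u : Fin n → U) (y : Fin n → Y) :
    ∑ s : Fin n → S, ∏ i, jointLaw pS κ V (s i, u i, y i)
      = ∏ i, auxOutLaw pS κ V (u i) (y i) :=
  sum_prod_eq_prod_sum (fun i x => jointLaw pS κ V (x, u i, y i))

lemma sum_prod_outLaw {n : ℕ} (y : Fin n → Y) :
    ∑ x : (Fin n → S) × (Fin n → U), ∏ i, jointLaw pS κ V (x.1 i, x.2 i, y i)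
      = ∏ i, outLaw pS κ V (y i) := by
  rw [Fintype.sum_prod_type]
  have := sum_prod_eq_prod_sum (fun (i : Fin n) (x : S × U) => jointLaw pS κ V (x.1, x.2, y i))
  rw [sum_arrow_prod] at this
  rw [this]
  simp only [Fintype.sum_prod_type, outLaw]

lemma sum_prod_auxOut_outLaw {n : ℕ} (y : Fin n → Y) :
    ∑ u : Fin n → U, ∏ i, auxOutLaw pS κ V (u i) (y i) = ∏ i, outLaw pS κ V (y i) := by
  rw [sum_prod_eq_prod_sum (fun i x => auxOutLaw pS κ V x (y i))]
  refine Finset.prod_congr rfl fun i _ => ?_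
  simp only [auxOutLaw, outLaw]
  exact Finset.sum_comm

lemma sum_stateAuxLaw (hpS1 : ∑ s, pS s = 1) (hκ1 : ∀ s, ∑ u, κ s u = 1) :
    ∑ x, stateAuxLaw pS κ x = 1 := by
  simp only [stateAuxLaw, Fintype.sum_prod_type, ← Finset.mul_sum, hκ1, mul_one, hpS1]

lemma sum_jointLaw (hpS1 : ∑ s, pS s = 1) (hκ1 : ∀ s, ∑ u, κ s u = 1)
    (hV1 : ∀ s u, ∑ y, V s u y = 1) : ∑ x, jointLaw pS κ V x = 1 := by
  simp only [jointLaw, Fintype.sum_prod_type, ← Finset.mul_sum, hκ1, mul_one, hV1, hpS1]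

lemma sum_auxLaw (hpS1 : ∑ s, pS s = 1) (hκ1 : ∀ s, ∑ u, κ s u = 1) :
    ∑ u, auxLaw pS κ u = 1 := by
  simp only [auxLaw]
  rw [Finset.sum_comm]
  simp only [← Finset.mul_sum, hκ1, mul_one, hpS1]

lemma sum_outLaw (hpS1 : ∑ s, pS s = 1) (hκ1 : ∀ s, ∑ u, κ s u = 1)
    (hV1 : ∀ s u, ∑ y, V s u y = 1) : ∑ y, outLaw pS κ V y = 1 := by
  rw [← sum_jointLaw hpS1 hκ1 hV1]
  simp only [outLaw, Fintype.sum_prod_type]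
  rw [Finset.sum_comm]
  exact Finset.sum_congr rfl fun s _ => Finset.sum_comm

section Nonneg

variable (hpS : ∀ s, 0 ≤ pS s) (hκ : ∀ s u, 0 ≤ κ s u) (hV : ∀ s u y, 0 ≤ V s u y)

include hpS hκ

lemma stateAuxLaw_nonneg (x : S × U) : 0 ≤ stateAuxLaw pS κ x := mul_nonneg (hpS _) (hκ _ _)

lemma auxLaw_nonneg (u : U) : 0 ≤ auxLaw pS κ u :=
  Finset.sum_nonneg fun s _ => mul_nonneg (hpS s) (hκ s u)

lemma stateAuxLaw_le_auxLaw (s : S) (u : U) : stateAuxLaw pS κ (s, u) ≤ auxLaw pS κ u :=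
  Finset.single_le_sum (f := fun s => pS s * κ s u) (fun s _ => mul_nonneg (hpS s) (hκ s u))
    (mem_univ s)

include hV

lemma jointLaw_nonneg (x : S × U × Y) : 0 ≤ jointLaw pS κ V x :=
  mul_nonneg (mul_nonneg (hpS _) (hκ _ _)) (hV _ _ _)

lemma auxOutLaw_nonneg (u : U) (y : Y) : 0 ≤ auxOutLaw pS κ V u y :=
  Finset.sum_nonneg fun _ _ => jointLaw_nonneg hpS hκ hV _

lemma outLaw_nonneg (y : Y) : 0 ≤ outLaw pS κ V y :=
  Finset.sum_nonneg fun _ _ => Finset.sum_nonneg fun _ _ => jointLaw_nonneg hpS hκ hV _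

lemma jointLaw_le_auxOutLaw (s : S) (u : U) (y : Y) :
    jointLaw pS κ V (s, u, y) ≤ auxOutLaw pS κ V u y :=
  Finset.single_le_sum (f := fun s => jointLaw pS κ V (s, u, y))
    (fun _ _ => jointLaw_nonneg hpS hκ hV _) (mem_univ s)

lemma jointLaw_le_outLaw (s : S) (u : U) (y : Y) :
    jointLaw pS κ V (s, u, y) ≤ outLaw pS κ V y :=
  (Finset.single_le_sum (f := fun u => jointLaw pS κ V (s, u, y))
    (fun _ _ => jointLaw_nonneg hpS hκ hV _) (mem_univ u)).trans
  (Finset.single_le_sum (f := fun s => ∑ u, jointLaw pS κ V (s, u, y))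
    (fun _ _ => Finset.sum_nonneg fun _ _ => jointLaw_nonneg hpS hκ hV _) (mem_univ s))

omit hV in
lemma pos_of_stateAuxLaw_pos {x : S × U} (hx : 0 < stateAuxLaw pS κ x) :
    0 < κ x.1 x.2 ∧ 0 < auxLaw pS κ x.2 :=
  ⟨(hκ _ _).lt_of_ne fun h => hx.ne (by simp [stateAuxLaw, ← h]),
    hx.trans_le (stateAuxLaw_le_auxLaw hpS hκ _ _)⟩

lemma pos_of_jointLaw_pos {x : S × U × Y} (hx : 0 < jointLaw pS κ V x) :
    0 < stateAuxLaw pS κ (x.1, x.2.1) ∧ 0 < V x.1 x.2.1 x.2.2 ∧ 0 < auxLaw pS κ x.2.1 ∧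
      0 < outLaw pS κ V x.2.2 ∧ 0 < auxOutLaw pS κ V x.2.1 x.2.2 := by
  have h1 : 0 < stateAuxLaw pS κ (x.1, x.2.1) :=
    (stateAuxLaw_nonneg hpS hκ _).lt_of_ne fun h => hx.ne (by
      simp only [stateAuxLaw] at h
      simp [jointLaw, ← h])
  exact ⟨h1, (hV _ _ _).lt_of_ne fun h => hx.ne (by simp [jointLaw, ← h]),
    (pos_of_stateAuxLaw_pos hpS hκ h1).2, hx.trans_le (jointLaw_le_outLaw hpS hκ hV _ _ _),
    hx.trans_le (jointLaw_le_auxOutLaw hpS hκ hV _ _ _)⟩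

end Nonneg

/-- Joint typicality of the state, the codeword and Bob's output. -/
def IsTypicalBob (pS : S → ℝ) (κ : S → U → ℝ) (V : S → U → Y → ℝ) (δ : ℝ) {n : ℕ}
    (t : Fin n → S × U × Y) : Prop :=
  IsTypical (jointLaw pS κ V) (fun x => auxLaw pS κ x.2.1 * outLaw pS κ V x.2.2)
      (jointLaw pS κ V) δ t ∧
    IsTypical (jointLaw pS κ V) (fun x => auxOutLaw pS κ V x.2.1 x.2.2) (jointLaw pS κ V) δ t

/-- Joint typicality of the state, the codeword and Eve's output. -/
def IsTypicalEve (pS : S → ℝ) (κ : S → U → ℝ) (V : S → U → Y → ℝ) (δ : ℝ) {n : ℕ}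
    (t : Fin n → S × U × Y) : Prop :=
  IsTypical (jointLaw pS κ V) (fun x => auxLaw pS κ x.2.1 * outLaw pS κ V x.2.2)
      (fun x => auxOutLaw pS κ V x.2.1 x.2.2) δ t ∧
    IsTypical (jointLaw pS κ V) (fun x => V x.1 x.2.1 x.2.2) (fun x => outLaw pS κ V x.2.2) δ t

/-- Joint typicality of the state and the codeword. -/
def IsTypicalEnc (pS : S → ℝ) (κ : S → U → ℝ) (δ : ℝ) {n : ℕ} (t : Fin n → S × U) : Prop :=
  IsTypical (stateAuxLaw pS κ) (fun x => κ x.1 x.2) (fun x => auxLaw pS κ x.2) δ t ∧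
    IsTypical (stateAuxLaw pS κ) (fun x => auxLaw pS κ x.2) (fun x => κ x.1 x.2) δ t

open Classical in
lemma tendsto_iidExp_not {α : Type*} [Fintype α] {p : α → ℝ} (hp : ∀ x, 0 ≤ p x)
    {T T₁ T₂ : ∀ n : ℕ, (Fin n → α) → Prop} (hT : ∀ n t, T₁ n t → T₂ n t → T n t)
    (h₁ : Tendsto (fun n => iidExp p (fun t => if T₁ n t then (0 : ℝ) else 1)) atTop (𝓝 0))
    (h₂ : Tendsto (fun n => iidExp p (fun t => if T₂ n t then (0 : ℝ) else 1)) atTop (𝓝 0)) :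
    Tendsto (fun n => iidExp p (fun t => if T n t then (0 : ℝ) else 1)) atTop (𝓝 0) := by
  refine tendsto_of_tendsto_of_tendsto_of_le_of_le tendsto_const_nhds
    (by simpa using h₁.add h₂) (fun n => Finset.sum_nonneg fun t _ =>
      mul_nonneg (Finset.prod_nonneg fun i _ => hp _) (by beta_reduce; split_ifs <;> simp))
    (fun n => ?_)
  beta_reduce
  rw [← iidExp_add]
  refine iidExp_mono hp fun t => ?_
  have := hT n t
  by_cases h1 : T₁ n t <;> by_cases h2 : T₂ n t <;> by_cases h3 : T n t <;> simp_all

section Tendsto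

variable (hpS : ∀ s, 0 ≤ pS s) (hpS1 : ∑ s, pS s = 1) (hκ : ∀ s u, 0 ≤ κ s u)
  (hκ1 : ∀ s, ∑ u, κ s u = 1) (hV : ∀ s u y, 0 ≤ V s u y) (hV1 : ∀ s u, ∑ y, V s u y = 1)
  {δ : ℝ} (hδ : 0 < δ)

include hpS hpS1 hκ hκ1 hδ

open Classical in
lemma tendsto_not_isTypicalEnc :
    Tendsto (fun n : ℕ => ∑ s : Fin n → S, (∏ i, pS (s i)) * ∑ u : Fin n → U,
      (∏ i, κ (s i) (u i)) * (if IsTypicalEnc pS κ δ (fun i => (s i, u i)) then 0 else 1))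
      atTop (𝓝 0) := by
  have hp := stateAuxLaw_nonneg hpS hκ
  have hp1 := sum_stateAuxLaw hpS1 hκ1
  have h1 : ∀ x, 0 < stateAuxLaw pS κ x → 0 < κ x.1 x.2 := fun x hx =>
    (pos_of_stateAuxLaw_pos hpS hκ hx).1
  have h2 : ∀ x, 0 < stateAuxLaw pS κ x → 0 < auxLaw pS κ x.2 := fun x hx =>
    (pos_of_stateAuxLaw_pos hpS hκ hx).2
  have := tendsto_iidExp_not (T := fun n t => IsTypicalEnc pS κ δ t) hp
    (fun n t ht1 ht2 => ⟨ht1, ht2⟩) (tendsto_iidExp_atypical hp hp1 h1 h2 hδ)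
    (tendsto_iidExp_atypical hp hp1 h2 h1 hδ)
  simpa only [iidExp_stateAuxLaw] using this

include hV hV1

open Classical in
lemma tendsto_not_isTypicalBob :
    Tendsto (fun n : ℕ => ∑ s : Fin n → S, (∏ i, pS (s i)) * ∑ u : Fin n → U,
      (∏ i, κ (s i) (u i)) * ∑ y : Fin n → Y, (∏ i, V (s i) (u i) (y i)) *
        (if IsTypicalBob pS κ V δ (fun i => (s i, u i, y i)) then 0 else 1)) atTop (𝓝 0) := by
  have hp := jointLaw_nonneg hpS hκ hV
  have hp1 := sum_jointLaw hpS1 hκ1 hV1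
  have hpos := fun x hx => pos_of_jointLaw_pos (x := x) hpS hκ hV hx
  have := tendsto_iidExp_not (T := fun n t => IsTypicalBob pS κ V δ t) hp
    (fun n t ht1 ht2 => ⟨ht1, ht2⟩)
    (tendsto_iidExp_atypical hp hp1 (fun x hx => mul_pos (hpos x hx).2.2.1 (hpos x hx).2.2.2.1)
      (fun x hx => hx) hδ)
    (tendsto_iidExp_atypical hp hp1 (fun x hx => (hpos x hx).2.2.2.2) (fun x hx => hx) hδ)
  simpa only [iidExp_jointLaw] using this

open Classical in
lemma tendsto_not_isTypicalEve :
    Tendsto (fun n : ℕ => ∑ s : Fin n → S, (∏ i, pS (s i)) * ∑ u : Fin n → U,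
      (∏ i, κ (s i) (u i)) * ∑ y : Fin n → Y, (∏ i, V (s i) (u i) (y i)) *
        (if IsTypicalEve pS κ V δ (fun i => (s i, u i, y i)) then 0 else 1)) atTop (𝓝 0) := by
  have hp := jointLaw_nonneg hpS hκ hV
  have hp1 := sum_jointLaw hpS1 hκ1 hV1
  have hpos := fun x hx => pos_of_jointLaw_pos (x := x) hpS hκ hV hx
  have := tendsto_iidExp_not (T := fun n t => IsTypicalEve pS κ V δ t) hp
    (fun n t ht1 ht2 => ⟨ht1, ht2⟩)
    (tendsto_iidExp_atypical hp hp1 (fun x hx => mul_pos (hpos x hx).2.2.1 (hpos x hx).2.2.2.1)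
      (fun x hx => (hpos x hx).2.2.2.2) hδ)
    (tendsto_iidExp_atypical hp hp1 (fun x hx => (hpos x hx).2.1)
      (fun x hx => (hpos x hx).2.2.2.1) hδ)
  simpa only [iidExp_jointLaw] using this

end Tendsto

end Block

/-! ### Block codes: list exponents and the choice of sizes -/

section BlockCode

variable {S U Y Z : Type*} [Fintype S] [Fintype U] [Fintype Y] [Fintype Z]
variable {pS : S → ℝ} {κ : S → U → ℝ} {V : S → U → Y → ℝ}

/-- Rounding up an exponential at most doubles it, since $e^x\ge1$ here. -/
lemma exists_nat_exp_le {x : ℝ} (hx : 0 ≤ x) :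
    ∃ N : ℕ, 0 < N ∧ Real.exp x ≤ N ∧ (N : ℝ) ≤ 2 * Real.exp x := by
  have h1 : 1 ≤ Real.exp x := Real.one_le_exp hx
  refine ⟨⌈Real.exp x⌉₊, Nat.ceil_pos.2 (Real.exp_pos x), Nat.le_ceil _, ?_⟩
  have := Nat.ceil_lt_add_one (Real.exp_pos x).le
  linarith

section Lists

variable (hpS : ∀ s, 0 ≤ pS s) (hκ : ∀ s u, 0 ≤ κ s u) (hV : ∀ s u y, 0 ≤ V s u y)

include hpS hκ hV

-- On the typical set $p(u^n)p(y^n)\le e^{n(\cdot)}p(s^n,u^n,y^n)$, and the right side sums over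
-- $(s^n,u^n)$ to a multiple of $p(y^n)$. The exponent is $H(S|U,Y)-I(U;Y)$ before the slack
-- $\delta$.
open Classical in
lemma sum_isTypicalBob_le {δ : ℝ} {n : ℕ} (y : Fin n → Y) :
    ∑ s : Fin n → S, ∑ u : Fin n → U, (∏ i, auxLaw pS κ (u i)) *
        (if IsTypicalBob pS κ V δ (fun i => (s i, u i, y i)) then 1 else 0)
      ≤ Real.exp (n * (∑ x, jointLaw pS κ V x * Real.log
        (auxLaw pS κ x.2.1 * outLaw pS κ V x.2.2 / jointLaw pS κ V x) + δ)) := by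
  rw [← Fintype.sum_prod_type' (f := fun (s : Fin n → S) (u : Fin n → U) =>
    (∏ i, auxLaw pS κ (u i)) *
        (if IsTypicalBob pS κ V δ (fun i => (s i, u i, y i)) then 1 else 0))]
  refine sum_mul_indicator_le (Q := fun x : (Fin n → S) × (Fin n → U) => ∏ i, auxLaw pS κ (x.2 i))
    (r := fun x => ∏ i, jointLaw pS κ V (x.1 i, x.2 i, y i))
    (fun x => Finset.prod_nonneg fun i _ => jointLaw_nonneg hpS hκ hV _) (sum_prod_outLaw y)
    (Real.exp_pos _).le (fun x => IsTypicalBob pS κ V δ (fun i => (x.1 i, x.2 i, y i))) ?_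
  rintro ⟨s, u⟩ ⟨⟨h1, h2⟩, -⟩
  rw [Finset.prod_mul_distrib] at h2
  exact ⟨h1, h2⟩

-- Each typical $s^n$ takes a share of at least $e^{-n(H(S|U,Y)+\delta)}$ of $p(u^n,y^n)$. This
-- counts the states that share the sent codeword.
open Classical in
lemma sum_isTypicalBob_state_le {δ : ℝ} {n : ℕ} (u : Fin n → U) (y : Fin n → Y) :
    ∑ s : Fin n → S, (if IsTypicalBob pS κ V δ (fun i => (s i, u i, y i)) then (1 : ℝ) else 0)
      ≤ Real.exp (n * (∑ x, jointLaw pS κ V x * Real.log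
        (auxOutLaw pS κ V x.2.1 x.2.2 / jointLaw pS κ V x) + δ)) := by
  have := sum_mul_indicator_le (Q := fun _ : Fin n → S => 1)
    (r := fun s => ∏ i, jointLaw pS κ V (s i, u i, y i))
    (c := Real.exp (n * (∑ x, jointLaw pS κ V x * Real.log
        (auxOutLaw pS κ V x.2.1 x.2.2 / jointLaw pS κ V x) + δ)))
    (fun x => Finset.prod_nonneg fun i _ => jointLaw_nonneg hpS hκ hV _) (sum_prod_auxOutLaw u y)
    (Real.exp_pos _).le (fun s => IsTypicalBob pS κ V δ (fun i => (s i, u i, y i))) (by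
      rintro s ⟨-, ⟨h1, h2⟩⟩
      exact ⟨h1, by rw [one_mul]; exact h2⟩)
  simpa only [one_mul] using this

-- The first likelihood ratio in Eve's typicality involves only $(u,z)$, so summing $p(u^n,z^n)$
-- over $u^n$ suffices. The exponent is $-I(U;Z)$ before the slack, uniformly in $s^n$.
open Classical in
lemma sum_isTypicalEve_le {δ : ℝ} {n : ℕ} (s : Fin n → S) (z : Fin n → Y) :
    ∑ u : Fin n → U, (∏ i, auxLaw pS κ (u i)) *
        (if IsTypicalEve pS κ V δ (fun i => (s i, u i, z i)) then 1 else 0)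
      ≤ Real.exp (n * (∑ x, jointLaw pS κ V x * Real.log
        (auxLaw pS κ x.2.1 * outLaw pS κ V x.2.2 / auxOutLaw pS κ V x.2.1 x.2.2) + δ)) := by
  refine sum_mul_indicator_le (Q := fun u : Fin n → U => ∏ i, auxLaw pS κ (u i))
    (r := fun u => ∏ i, auxOutLaw pS κ V (u i) (z i))
    (fun x => Finset.prod_nonneg fun i _ => auxOutLaw_nonneg hpS hκ hV _ _)
    (sum_prod_auxOut_outLaw z)
    (Real.exp_pos _).le (fun u => IsTypicalEve pS κ V δ (fun i => (s i, u i, z i))) ?_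
  rintro u ⟨⟨h1, h2⟩, -⟩
  rw [Finset.prod_mul_distrib] at h2
  exact ⟨h1.trans_le (Finset.prod_le_prod (fun i _ => jointLaw_nonneg hpS hκ hV _)
    fun i _ => jointLaw_le_auxOutLaw hpS hκ hV _ _ _), h2⟩

end Lists

lemma sum_prod_kernel {n : ℕ} {D : Type*} [Fintype D] {f : Fin n → D → ℝ}
    (hf : ∀ i, ∑ d, f i d = 1) : ∑ t : Fin n → D, ∏ i, f i (t i) = 1 := by
  rw [sum_prod_eq_prod_sum f]
  simp [hf]

open Classical in
/-- Markov's inequality for three conditions on a pair. -/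
lemma sum_not_le_add_div_add_div {𝒮 𝒰 : Type*} [Fintype 𝒮] [Fintype 𝒰] {p : 𝒮 → ℝ} {κ f g : 𝒮 → 𝒰 → ℝ}
    (hp : ∀ s, 0 ≤ p s) (hκ : ∀ s u, 0 ≤ κ s u) (hf : ∀ s u, 0 ≤ f s u) (hg : ∀ s u, 0 ≤ g s u)
    (A E : 𝒮 → 𝒰 → Prop) {η : ℝ} (hη : 0 < η)
    (hA : ∀ s u, E s u → f s u ≤ η → g s u ≤ η → A s u) :
    ∑ s, p s * ∑ u, κ s u * (if A s u then 0 else 1)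
      ≤ (∑ s, p s * ∑ u, κ s u * (if E s u then 0 else 1))
        + (∑ s, p s * ∑ u, κ s u * f s u) / η + (∑ s, p s * ∑ u, κ s u * g s u) / η := by
  simp only [Finset.sum_div, ← Finset.sum_add_distrib, Finset.mul_sum, mul_div_assoc, ← mul_add]
  refine Finset.sum_le_sum fun s _ => Finset.sum_le_sum fun u _ =>
    mul_le_mul_of_nonneg_left (mul_le_mul_of_nonneg_left ?_ (hκ s u)) (hp s)
  have h1 : 0 ≤ f s u / η := div_nonneg (hf s u) hη.le
  have h2 : 0 ≤ g s u / η := div_nonneg (hg s u) hη.le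
  by_cases hAsu : A s u
  · rw [if_pos hAsu]
    split_ifs <;> positivity
  rw [if_neg hAsu]
  by_cases hE : E s u
  · rw [if_pos hE]
    by_cases h3 : f s u ≤ η
    · have h4 : η < g s u := not_le.1 fun h4 => hAsu (hA s u hE h3 h4)
      have : 1 ≤ g s u / η := (one_le_div hη).2 h4.le
      linarith
    · have : 1 ≤ f s u / η := (one_le_div hη).2 (not_le.1 h3).le
      linarith
  · rw [if_neg hE]
    linarith

lemma log_card_arrow {n : ℕ} {D : Type*} [Fintype D] :
    Real.log (Fintype.card (Fin n → D)) = n * Real.log (Fintype.card D) := by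
  simp

/-- The numerical bound behind the choice of the code rates. -/
lemma random_coding_exponent_le {n M J l : ℕ} {δ i R Rm a₁ a₂ c₁ B C : ℝ}
    (hJ1 : Real.exp (n * (i + 2 * δ)) ≤ J) (hJ2 : (J : ℝ) ≤ 2 * Real.exp (n * (i + 2 * δ)))
    (hl2 : (l : ℝ) ≤ 2 * Real.exp (n * R)) (hM1 : Real.exp (n * Rm) ≤ M)
    (hB₁ : i + R + a₁ + 7 * δ ≤ B) (hB₂ : a₂ - Rm + 5 * δ ≤ B) (hC : i + R + c₁ + 7 * δ ≤ C) :
    Real.exp (-(J / Real.exp (n * (i + δ))))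
      + J * Real.exp (n * (-i + δ)) * (J * l * Real.exp (n * (a₁ + δ))
        + Real.exp (n * (a₂ + δ)) / M) / Real.exp (n * B)
      + J * Real.exp (n * (-i + δ)) * (J * l * Real.exp (n * (c₁ + δ))) / Real.exp (n * C)
      ≤ 19 * Real.exp (-(n * δ)) := by
  -- Already $J/e^{n(i+\delta)}\ge e^{n\delta}\ge n\delta$, so the doubly exponential covering error
  -- is far below what is claimed.
  have h₁ : Real.exp (-(J / Real.exp (n * (i + δ)))) ≤ Real.exp (-(n * δ)) := by
    rw [Real.exp_le_exp, neg_le_neg_iff, le_div_iff₀ (Real.exp_pos _)]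
    calc n * δ * Real.exp (n * (i + δ)) ≤ Real.exp (n * δ) * Real.exp (n * (i + δ)) := by
          gcongr
          linarith [Real.add_one_le_exp (n * δ)]
      _ = Real.exp (n * (i + 2 * δ)) := by rw [← Real.exp_add]; ring_nf
      _ ≤ J := hJ1
  -- The factor $8=2^3$ comes from rounding `J` twice and `l` once, and the $2$ of the collision
  -- term from rounding `J` once. The surplus $\delta$ in `hB₁` and `hB₂` gives the decay.
  have h₂ : J * Real.exp (n * (-i + δ)) * (J * l * Real.exp (n * (a₁ + δ))
      + Real.exp (n * (a₂ + δ)) / M) / Real.exp (n * B) ≤ 10 * Real.exp (-(n * δ)) := by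
    calc _ ≤ 2 * Real.exp (n * (i + 2 * δ)) * Real.exp (n * (-i + δ)) *
          (2 * Real.exp (n * (i + 2 * δ)) * (2 * Real.exp (n * R)) * Real.exp (n * (a₁ + δ))
          + Real.exp (n * (a₂ + δ)) / Real.exp (n * Rm)) / Real.exp (n * B) := by gcongr
      _ = 8 * Real.exp (n * (6 * δ + i + R + a₁ - B))
          + 2 * Real.exp (n * (4 * δ + a₂ - Rm - B)) := by
          have h1 : Real.exp (n * (6 * δ + i + R + a₁ - B)) = Real.exp (n * (i + 2 * δ)) *
            Real.exp (n * (-i + δ)) * Real.exp (n * (i + 2 * δ)) * Real.exp (n * R) *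
            Real.exp (n * (a₁ + δ)) / Real.exp (n * B) := by
            simp only [← Real.exp_add, ← Real.exp_sub]
            ring_nf
          have h2 : Real.exp (n * (4 * δ + a₂ - Rm - B)) = Real.exp (n * (i + 2 * δ)) *
            Real.exp (n * (-i + δ)) * Real.exp (n * (a₂ + δ)) / Real.exp (n * Rm) /
            Real.exp (n * B) := by
            simp only [← Real.exp_add, ← Real.exp_sub]
            ring_nf
          rw [h1, h2]
          ring
      _ ≤ 8 * Real.exp (n * (-δ)) + 2 * Real.exp (n * (-δ)) := by
          gcongr <;> linarith
      _ = 10 * Real.exp (-(n * δ)) := by ring_nf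
  have h₃ : J * Real.exp (n * (-i + δ)) * (J * l * Real.exp (n * (c₁ + δ)))
      / Real.exp (n * C) ≤ 8 * Real.exp (-(n * δ)) := by
    calc _ ≤ 2 * Real.exp (n * (i + 2 * δ)) * Real.exp (n * (-i + δ)) *
          (2 * Real.exp (n * (i + 2 * δ)) * (2 * Real.exp (n * R)) * Real.exp (n * (c₁ + δ)))
          / Real.exp (n * C) := by gcongr
      _ = 8 * Real.exp (n * (6 * δ + i + R + c₁ - C)) := by
          have h1 : Real.exp (n * (6 * δ + i + R + c₁ - C)) = Real.exp (n * (i + 2 * δ)) *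
            Real.exp (n * (-i + δ)) * Real.exp (n * (i + 2 * δ)) * Real.exp (n * R) *
            Real.exp (n * (c₁ + δ)) / Real.exp (n * C) := by
            simp only [← Real.exp_add, ← Real.exp_sub]
            ring_nf
          rw [h1]
          ring
      _ ≤ 8 * Real.exp (n * (-δ)) := by
          gcongr
          linarith
      _ = 8 * Real.exp (-(n * δ)) := by ring_nf
  linarith

/-- **Achievability for blocks**, in nats. Here `R` is the rate of the local randomness, `Rm` that
of the hash of the state, `B` that of Bob's list and `C` that of Eve's list. -/
theorem eventually_exists_block_code [Nonempty S] [Nonempty Y] [Nonempty Z]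
    (hpS : ∀ s, 0 ≤ pS s) (hpS1 : ∑ s, pS s = 1) (hκ : ∀ s u, 0 ≤ κ s u)
    (hκ1 : ∀ s, ∑ u, κ s u = 1)
    {VY : S → U → Y → ℝ} (hVY : ∀ s u y, 0 ≤ VY s u y) (hVY1 : ∀ s u, ∑ y, VY s u y = 1)
    {VZ : S → U → Z → ℝ} (hVZ : ∀ s u z, 0 ≤ VZ s u z) (hVZ1 : ∀ s u, ∑ z, VZ s u z = 1)
    {i a₁ a₂ c₁ c₂ : ℝ}
    (hi : i = ∑ x, stateAuxLaw pS κ x * Real.log (κ x.1 x.2 / auxLaw pS κ x.2))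
    (ha₁ : a₁ = ∑ x, jointLaw pS κ VY x * Real.log
        (auxLaw pS κ x.2.1 * outLaw pS κ VY x.2.2 / jointLaw pS κ VY x))
    (ha₂ : a₂ = ∑ x, jointLaw pS κ VY x * Real.log
        (auxOutLaw pS κ VY x.2.1 x.2.2 / jointLaw pS κ VY x))
    (hc₁ : c₁ = ∑ x, jointLaw pS κ VZ x * Real.log
        (auxLaw pS κ x.2.1 * outLaw pS κ VZ x.2.2 / auxOutLaw pS κ VZ x.2.1 x.2.2))
    (hc₂ : c₂ = ∑ x, jointLaw pS κ VZ x * Real.log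
        (VZ x.1 x.2.1 x.2.2 / outLaw pS κ VZ x.2.2))
    (hi0 : 0 ≤ i) (hc₂0 : 0 ≤ c₂) {δ η R Rm B C : ℝ} (hδ : 0 < δ) (hη : 0 < η) (hR : 0 ≤ R)
    (hRm : 0 ≤ Rm) (hB0 : 0 ≤ B) (hC0 : 0 ≤ C)
    (hB₁ : i + R + a₁ + 7 * δ ≤ B) (hB₂ : a₂ - Rm + 5 * δ ≤ B) (hC : i + R + c₁ + 7 * δ ≤ C) :
    ∀ᶠ n : ℕ in atTop, ∃ l : ℕ, 0 < l ∧ Real.exp (n * R) ≤ l ∧ (l : ℝ) ≤ 2 * Real.exp (n * R) ∧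
      ∃ w : (Fin n → S) → Fin l → (Fin n → U),
        let PY := codeLaw (fun s => ∏ i, pS (s i)) w
          (fun s u (y : Fin n → Y) => ∏ i, VY (s i) (u i) (y i))
        let PZ := codeLaw (fun s => ∏ i, pS (s i)) w
          (fun s u (z : Fin n → Z) => ∏ i, VZ (s i) (u i) (z i))
        natEntropy PY (fun x => (x.1, x.2.2)) - natEntropy PY (fun x => x.2.2)
            ≤ Real.log 2 + n * B + 2 * η * (n * Real.log (Fintype.card S)) + 2 ∧
        natEntropy PZ (fun x => x.1) + natEntropy PZ (fun x => x.2.2)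
            - natEntropy PZ (fun x => (x.1, x.2.2))
            ≤ Real.log 2 + n * (c₂ + δ) + 2 * η * (n * Real.log (Fintype.card Z)) - Real.log l
              + (natEntropy PZ (fun x => (x.2.1, (x.1, x.2.2)))
                - natEntropy PZ (fun x => (x.1, x.2.2))) ∧
        natEntropy PZ (fun x => (x.2.1, (x.1, x.2.2))) - natEntropy PZ (fun x => (x.1, x.2.2))
            ≤ Real.log 2 + n * C + 2 * η * Real.log l + 2 := by
  classical
  set TY : ∀ n : ℕ, (Fin n → S) → (Fin n → U) → (Fin n → Y) → Prop := fun n s u y =>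
    IsTypicalBob pS κ VY δ (fun i => (s i, u i, y i)) with hTY
  set TZ : ∀ n : ℕ, (Fin n → S) → (Fin n → U) → (Fin n → Z) → Prop := fun n s u z =>
    IsTypicalEve pS κ VZ δ (fun i => (s i, u i, z i)) with hTZ
  set f : ∀ n : ℕ, (Fin n → S) → (Fin n → U) → ℝ := fun n s u =>
    ∑ y : Fin n → Y, (∏ i, VY (s i) (u i) (y i)) * (if TY n s u y then 0 else 1) with hf
  set g : ∀ n : ℕ, (Fin n → S) → (Fin n → U) → ℝ := fun n s u =>
    ∑ z : Fin n → Z, (∏ i, VZ (s i) (u i) (z i)) * (if TZ n s u z then 0 else 1) with hg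
  -- Besides typicality with the state, a codeword must make the outputs of both Bob and Eve typical
  -- with conditional probability at least $1-\eta$. Markov's inequality shows that this costs
  -- little, and it replaces a conditional typicality lemma.
  obtain ⟨A, hA⟩ : ∃ A : ∀ n : ℕ, (Fin n → S) → (Fin n → U) → Prop, ∀ n s u, A n s u ↔
    IsTypicalEnc pS κ δ (fun i => (s i, u i)) ∧ f n s u ≤ η ∧ g n s u ≤ η :=
    ⟨_, fun _ _ _ => Iff.rfl⟩
  set e₀ : ℕ → ℝ := fun n => ∑ s : Fin n → S, (∏ i, pS (s i)) * ∑ u : Fin n → U,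
      (∏ i, κ (s i) (u i)) * (if IsTypicalEnc pS κ δ (fun i => (s i, u i)) then 0 else 1)
    with he₀
  set e₁ : ℕ → ℝ := fun n => ∑ s : Fin n → S, (∏ i, pS (s i)) * ∑ u : Fin n → U,
      (∏ i, κ (s i) (u i)) * f n s u with he₁
  set e₂ : ℕ → ℝ := fun n => ∑ s : Fin n → S, (∏ i, pS (s i)) * ∑ u : Fin n → U,
      (∏ i, κ (s i) (u i)) * g n s u with he₂
  have ht₀ : Tendsto e₀ atTop (𝓝 0) := tendsto_not_isTypicalEnc hpS hpS1 hκ hκ1 hδ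
  have ht₁ : Tendsto e₁ atTop (𝓝 0) := tendsto_not_isTypicalBob hpS hpS1 hκ hκ1 hVY hVY1 hδ
  have ht₂ : Tendsto e₂ atTop (𝓝 0) := tendsto_not_isTypicalEve hpS hpS1 hκ hκ1 hVZ hVZ1 hδ
  have hexp : Tendsto (fun n : ℕ => Real.exp (-(n * δ))) atTop (𝓝 0) :=
    Real.tendsto_exp_neg_atTop_nhds_zero.comp
      (tendsto_natCast_atTop_atTop.atTop_mul_const hδ)
  have hτ : Tendsto (fun n : ℕ => e₀ n + e₁ n / η + e₂ n / η + 19 * Real.exp (-(n * δ)))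
      atTop (𝓝 0) := by
    simpa using ((ht₀.add (ht₁.div_const η)).add (ht₂.div_const η)).add (hexp.const_mul 19)
  -- The bound by $\eta$ serves the failure probability, and the bound by $1$ serves the two
  -- normalized list sizes, which enter the entropy bounds as additive constants.
  filter_upwards [hτ.eventually_le_const (lt_min hη one_pos)] with n hn
  obtain ⟨M, hM0, hM1, -⟩ := exists_nat_exp_le (x := n * Rm) (by positivity)
  obtain ⟨J, hJ0, hJ1, hJ2⟩ := exists_nat_exp_le (x := n * (i + 2 * δ)) (by positivity)
  obtain ⟨l, hl0, hl1, hl2⟩ := exists_nat_exp_le (x := n * R) (by positivity)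
  have : Nonempty (Fin M) := ⟨⟨0, hM0⟩⟩
  have : Nonempty (Fin J) := ⟨⟨0, hJ0⟩⟩
  have : Nonempty (Fin l) := ⟨⟨0, hl0⟩⟩
  refine ⟨l, hl0, hl1, hl2, ?_⟩
  have hp : ∀ s : Fin n → S, 0 ≤ ∏ i, pS (s i) := fun s => Finset.prod_nonneg fun i _ => hpS _
  have hp1 : ∑ s : Fin n → S, ∏ i, pS (s i) = 1 := sum_prod_kernel fun _ => hpS1
  have hVYn : ∀ (s : Fin n → S) (u : Fin n → U) (y : Fin n → Y), 0 ≤ ∏ i, VY (s i) (u i) (y i) :=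
    fun s u y => Finset.prod_nonneg fun i _ => hVY _ _ _
  have hVYn1 : ∀ (s : Fin n → S) (u : Fin n → U), ∑ y : Fin n → Y, ∏ i, VY (s i) (u i) (y i) = 1 :=
    fun s u => sum_prod_kernel fun _ => hVY1 _ _
  have hVZn : ∀ (s : Fin n → S) (u : Fin n → U) (z : Fin n → Z), 0 ≤ ∏ i, VZ (s i) (u i) (z i) :=
    fun s u z => Finset.prod_nonneg fun i _ => hVZ _ _ _
  have hVZn1 : ∀ (s : Fin n → S) (u : Fin n → U), ∑ z : Fin n → Z, ∏ i, VZ (s i) (u i) (z i) = 1 :=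
    fun s u => sum_prod_kernel fun _ => hVZ1 _ _
  have hκn : ∀ (s : Fin n → S) (u : Fin n → U), 0 ≤ ∏ i, κ (s i) (u i) :=
    fun s u => Finset.prod_nonneg fun i _ => hκ _ _
  have hi' : -i = ∑ x, stateAuxLaw pS κ x * Real.log (auxLaw pS κ x.2 / κ x.1 x.2) := by
    rw [hi, ← Finset.sum_neg_distrib]
    refine Finset.sum_congr rfl fun x _ => ?_
    rw [← inv_div, Real.log_inv, mul_neg, neg_neg]
  obtain ⟨w, ΛY, ΛZ, hΛY, hΛZ, hw⟩ := exists_code hp hp1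
    (Q := fun u : Fin n → U => ∏ i, auxLaw pS κ (u i))
    (fun u => Finset.prod_nonneg fun i _ => auxLaw_nonneg hpS hκ _)
    (sum_prod_kernel fun _ => sum_auxLaw hpS1 hκ1)
    (κ := fun s u => ∏ i, κ (s i) (u i)) hκn (fun s => sum_prod_kernel fun _ => hκ1 _)
    (VY := fun s u y => ∏ i, VY (s i) (u i) (y i)) hVYn hVYn1
    (VZ := fun s u z => ∏ i, VZ (s i) (u i) (z i)) hVZn hVZn1 (A n) (TY n) (TZ n)
    (α₁ := Real.exp (n * (i + δ))) (α₂ := Real.exp (n * (-i + δ)))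
    (βa := Real.exp (n * (a₁ + δ))) (βb := Real.exp (n * (a₂ + δ)))
    (γ := Real.exp (n * (c₁ + δ))) (KY := Real.exp (n * B)) (KZ := Real.exp (n * C))
    (Real.exp_pos _) (Real.exp_pos _).le (Real.exp_pos _).le (Real.exp_pos _).le
    (Real.exp_pos _).le (Real.exp_pos _) (Real.exp_pos _)
    (fun s u h => by rw [hi]; exact ((hA n s u).1 h).1.1.2) (fun s u h => by rw [hi']; exact ((hA n s u).1 h).1.2.2)
    (fun y => by rw [ha₁]; exact sum_isTypicalBob_le hpS hκ hVY y)
    (fun u y => by rw [ha₂]; exact sum_isTypicalBob_state_le hpS hκ hVY u y)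
    (fun s z => by rw [hc₁]; exact sum_isTypicalEve_le hpS hκ hVZ s z)
    (Fin M) (Fin J) (Fin l)
  simp only [Fintype.card_fin] at hw
  have hbounds := random_coding_exponent_le hJ1 hJ2 hl2 hM1 hB₁ hB₂ hC
  have hbound₀ := sum_not_le_add_div_add_div hp hκn
    (f := f n) (g := g n) (A := A n) (E := fun (s : Fin n → S) (u : Fin n → U) =>
    IsTypicalEnc pS κ δ (fun i => (s i, u i))) (fun s u => Finset.sum_nonneg fun y _ => mul_nonneg (hVYn s u y)
      (by split_ifs <;> simp)) (fun s u => Finset.sum_nonneg fun y _ => mul_nonneg (hVZn s u y)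
      (by split_ifs <;> simp)) hη (fun s u h1 h2 h3 => (hA n s u).2 ⟨h1, h2, h3⟩)
  set X₀ := ∑ s, ∑ j : Fin l, (∏ i, pS (s i)) * (l : ℝ)⁻¹ *
    (if A n s (w s j) then (0 : ℝ) else 1) with hX₀
  set X₁ := ∑ s, ∑ j : Fin l, (∏ i, pS (s i)) * (l : ℝ)⁻¹ * (if A n s (w s j) then
    ∑ y, (∏ i, VY (s i) (w s j i) (y i)) * (((ΛY y).erase s).card : ℝ) else 0) with hX₁
  set X₂ := ∑ s, ∑ j : Fin l, (∏ i, pS (s i)) * (l : ℝ)⁻¹ * (if A n s (w s j) then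
    ∑ z, (∏ i, VZ (s i) (w s j i) (z i)) * (((ΛZ s z).erase j).card : ℝ) else 0) with hX₂
  have hX₀0 : 0 ≤ X₀ := Finset.sum_nonneg fun s _ => Finset.sum_nonneg fun j _ =>
    mul_nonneg (mul_nonneg (hp s) (by positivity)) (by split_ifs <;> simp)
  have hX₁0 : 0 ≤ X₁ / Real.exp (n * B) := by
    refine div_nonneg (Finset.sum_nonneg fun s _ => Finset.sum_nonneg fun j _ =>
      mul_nonneg (mul_nonneg (hp s) (by positivity)) ?_) (Real.exp_pos _).le
    split_ifs
    · exact Finset.sum_nonneg fun y _ => mul_nonneg (hVYn _ _ _) (Nat.cast_nonneg _)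
    · exact le_rfl
  have hX₂0 : 0 ≤ X₂ / Real.exp (n * C) := by
    refine div_nonneg (Finset.sum_nonneg fun s _ => Finset.sum_nonneg fun j _ =>
      mul_nonneg (mul_nonneg (hp s) (by positivity)) ?_) (Real.exp_pos _).le
    split_ifs
    · exact Finset.sum_nonneg fun y _ => mul_nonneg (hVZn _ _ _) (Nat.cast_nonneg _)
    · exact le_rfl
  have htotal : X₀ + X₁ / Real.exp (n * B) + X₂ / Real.exp (n * C) ≤ min η 1 := by
    refine le_trans ?_ ((add_le_add hbound₀ hbounds).trans hn)
    rw [← add_assoc, ← add_assoc]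
    exact hw
  have hle₁ := htotal.trans (min_le_left _ _)
  have hle₂ := htotal.trans (min_le_right _ _)
  have hX₀η : X₀ + η ≤ 2 * η := by linarith
  have hKY : 1 ≤ Real.exp (n * B) := Real.one_le_exp (by positivity)
  have hKZ : 1 ≤ Real.exp (n * C) := Real.one_le_exp (by positivity)
  have hζ : 1 ≤ Real.exp (n * (c₂ + δ)) := Real.one_le_exp (by positivity)
  have hlogS : 0 ≤ Real.log (Fintype.card S) :=
    Real.log_nonneg (by exact_mod_cast Fintype.card_pos)
  have hlogZ : 0 ≤ Real.log (Fintype.card Z) :=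
    Real.log_nonneg (by exact_mod_cast Fintype.card_pos)
  have hlogl : 0 ≤ Real.log l := Real.log_nonneg (by exact_mod_cast hl0)
  have hBob := natCondEntropy_state_le (w := w) hp hp1 hVYn hVYn1 (A n) (TY n) hη.le
    (fun s u h => ((hA n s u).1 h).2.1) ΛY hΛY hKY
  have hEve := natMutualInfo_state_le (w := w) hp hp1 hVZn hVZn1 (A n) (TZ n) hη.le
    (fun s u h => ((hA n s u).1 h).2.2) (q := fun z => ∏ i, outLaw pS κ VZ (z i))
    (fun z => Finset.prod_nonneg fun i _ => outLaw_nonneg hpS hκ hVZ _)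
    (sum_prod_kernel fun _ => sum_outLaw hpS1 hκ1 hVZ1).le hζ
    (fun s u z h => by rw [hc₂]; exact h.2.2)
  have hIdx := natCondEntropy_index_le (w := w) hp hp1 hVZn hVZn1 (A n) (TZ n) hη.le
    (fun s u h => ((hA n s u).1 h).2.2) ΛZ hΛZ hKZ
  simp only [Fintype.card_fin, log_card_arrow, Real.log_exp, ← hX₀, ← hX₁, ← hX₂, add_div]
    at hBob hEve hIdx
  have hinvY : 1 / Real.exp (n * B) ≤ 1 := (div_le_one (Real.exp_pos _)).2 hKY
  have hinvZ : 1 / Real.exp (n * C) ≤ 1 := (div_le_one (Real.exp_pos _)).2 hKZ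
  refine ⟨w, ?_, ?_, ?_⟩
  · have h1 := mul_le_mul_of_nonneg_right hX₀η
      (by positivity : 0 ≤ n * Real.log (Fintype.card S))
    linarith
  · have h1 := mul_le_mul_of_nonneg_right hX₀η
      (by positivity : 0 ≤ n * Real.log (Fintype.card Z))
    linarith
  · have h1 := mul_le_mul_of_nonneg_right hX₀η hlogl
    linarith

end BlockCode

/-! ### Mutual information depends only on the joint law -/

section Transfer

variable {Ω Ω' A B : Type*} [Fintype Ω] [Fintype Ω'] [Fintype A] [Fintype B]

lemma natEntropy_law {C : Type*} [Fintype C] (P : Ω → ℝ) (g : Ω → A) (f : A → C) :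
    natEntropy (law P g) f = natEntropy P (fun ω => f (g ω)) :=
  natEntropy_congr (law_comp P g f)

lemma mutualInfo_eq_of_law_eq {P : Ω → ℝ} {f : Ω → A} {g : Ω → B} {P' : Ω' → ℝ} {f' : Ω' → A}
    {g' : Ω' → B}
    (h : law P (fun ω => (f ω, g ω)) = law P' (fun ω => (f' ω, g' ω))) :
    mutualInfo P f g = mutualInfo P' f' g' := by
  have h1 := natEntropy_law P (fun ω => (f ω, g ω)) Prod.fst
  have h2 := natEntropy_law P (fun ω => (f ω, g ω)) Prod.snd
  rw [h, natEntropy_law] at h1 h2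
  rw [mutualInfo_eq, mutualInfo_eq, natEntropy_congr h, ← h1, ← h2]

end Transfer

/-! ### Exponents as single-letter entropies -/

section SingleLetter

variable {S U Y : Type*} [Fintype S] [Fintype U] [Fintype Y]
  {pS : S → ℝ} {κ : S → U → ℝ} {V : S → U → Y → ℝ}

lemma law_jointLaw_stateAux (hV1 : ∀ s u, ∑ y, V s u y = 1) :
    law (jointLaw pS κ V) (fun x => (x.1, x.2.1)) = stateAuxLaw pS κ := by
  classical
  ext ⟨s, u⟩
  rw [law_eq_sum]
  simp [Fintype.sum_prod_type, jointLaw, stateAuxLaw, ite_and, Finset.sum_ite_irrel,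
    ← Finset.mul_sum, hV1]

lemma law_jointLaw_state (hκ1 : ∀ s, ∑ u, κ s u = 1) (hV1 : ∀ s u, ∑ y, V s u y = 1) :
    law (jointLaw pS κ V) (fun x => x.1) = pS := by
  classical
  ext s
  rw [law_eq_sum]
  simp [Fintype.sum_prod_type, jointLaw, Finset.sum_ite_irrel, ← Finset.mul_sum, hV1, hκ1]

lemma law_jointLaw_aux (hV1 : ∀ s u, ∑ y, V s u y = 1) :
    law (jointLaw pS κ V) (fun x => x.2.1) = auxLaw pS κ := by
  classical
  ext u
  rw [law_eq_sum]
  simp [Fintype.sum_prod_type, jointLaw, auxLaw, Finset.sum_ite_irrel, ← Finset.mul_sum, hV1]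

lemma law_jointLaw_out : law (jointLaw pS κ V) (fun x => x.2.2) = outLaw pS κ V := by
  classical
  ext y
  rw [law_eq_sum]
  simp [Fintype.sum_prod_type, outLaw]

lemma law_jointLaw_auxOut :
    law (jointLaw pS κ V) (fun x => (x.2.1, x.2.2)) = fun t => auxOutLaw pS κ V t.1 t.2 := by
  classical
  ext ⟨u, y⟩
  rw [law_eq_sum]
  simp [Fintype.sum_prod_type, auxOutLaw]

lemma law_self {α : Type*} [Fintype α] (P : α → ℝ) : law P (fun x => x) = P := by
  classical
  ext x
  simp [law_eq_sum]

variable (hpS : ∀ s, 0 ≤ pS s) (hκ : ∀ s u, 0 ≤ κ s u) (hκ1 : ∀ s, ∑ u, κ s u = 1)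
  (hV : ∀ s u y, 0 ≤ V s u y) (hV1 : ∀ s u, ∑ y, V s u y = 1)

include hpS hκ hV hV1

/-- The logarithm splits letterwise where the joint law is positive, and zero-probability letters
carry zero weight. The value is $H(S|U,Y)-I(U;Y)$. The neighbouring identities follow the same
pattern. -/
lemma sum_log_aux_out_joint :
    ∑ x, jointLaw pS κ V x * Real.log
        (auxLaw pS κ x.2.1 * outLaw pS κ V x.2.2 / jointLaw pS κ V x)
      = natEntropy (jointLaw pS κ V) (fun x => x) - natEntropy (jointLaw pS κ V) (fun x => x.2.1)
        - natEntropy (jointLaw pS κ V) (fun x => x.2.2) := by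
  simp only [natEntropy, law_jointLaw_aux hV1, law_jointLaw_out, law_self,
    ← Finset.sum_sub_distrib]
  refine Finset.sum_congr rfl fun x _ => ?_
  rcases (jointLaw_nonneg hpS hκ hV x).eq_or_lt with h | h
  · simp [← h]
  obtain ⟨h1, h2, h3, h4, h5⟩ := pos_of_jointLaw_pos hpS hκ hV h
  rw [Real.log_div (mul_pos h3 h4).ne' h.ne', Real.log_mul h3.ne' h4.ne']
  ring

lemma sum_log_auxOut_joint :
    ∑ x, jointLaw pS κ V x * Real.log (auxOutLaw pS κ V x.2.1 x.2.2 / jointLaw pS κ V x)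
      = natEntropy (jointLaw pS κ V) (fun x => x)
        - natEntropy (jointLaw pS κ V) (fun x => (x.2.1, x.2.2)) := by
  simp only [natEntropy, law_jointLaw_auxOut, law_self, ← Finset.sum_sub_distrib]
  refine Finset.sum_congr rfl fun x _ => ?_
  rcases (jointLaw_nonneg hpS hκ hV x).eq_or_lt with h | h
  · simp [← h]
  obtain ⟨h1, h2, h3, h4, h5⟩ := pos_of_jointLaw_pos hpS hκ hV h
  rw [Real.log_div h5.ne' h.ne']
  ring

lemma sum_log_aux_out_auxOut :
    ∑ x, jointLaw pS κ V x * Real.log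
        (auxLaw pS κ x.2.1 * outLaw pS κ V x.2.2 / auxOutLaw pS κ V x.2.1 x.2.2)
      = natEntropy (jointLaw pS κ V) (fun x => (x.2.1, x.2.2))
        - natEntropy (jointLaw pS κ V) (fun x => x.2.1)
        - natEntropy (jointLaw pS κ V) (fun x => x.2.2) := by
  simp only [natEntropy, law_jointLaw_aux hV1, law_jointLaw_out, law_jointLaw_auxOut,
    ← Finset.sum_sub_distrib]
  refine Finset.sum_congr rfl fun x _ => ?_
  rcases (jointLaw_nonneg hpS hκ hV x).eq_or_lt with h | h
  · simp [← h]
  obtain ⟨h1, h2, h3, h4, h5⟩ := pos_of_jointLaw_pos hpS hκ hV h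
  rw [Real.log_div (mul_pos h3 h4).ne' h5.ne', Real.log_mul h3.ne' h4.ne']
  ring

/-- Factoring the joint law as $p(s,u)V(y|s,u)$ identifies the expected log ratio with $I(S,U;Y)$,
the leakage rate before the local randomness is subtracted. -/
lemma sum_log_kernel_out :
    ∑ x, jointLaw pS κ V x * Real.log (V x.1 x.2.1 x.2.2 / outLaw pS κ V x.2.2)
      = natEntropy (jointLaw pS κ V) (fun x => (x.1, x.2.1))
        + natEntropy (jointLaw pS κ V) (fun x => x.2.2)
        - natEntropy (jointLaw pS κ V) (fun x => x) := by
  simp only [natEntropy, law_jointLaw_stateAux hV1, law_jointLaw_out, law_self,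
    ← Finset.sum_sub_distrib, ← Finset.sum_add_distrib]
  refine Finset.sum_congr rfl fun x _ => ?_
  rcases (jointLaw_nonneg hpS hκ hV x).eq_or_lt with h | h
  · simp [← h]
  obtain ⟨h1, h2, h3, h4, h5⟩ := pos_of_jointLaw_pos hpS hκ hV h
  have h6 : Real.log (jointLaw pS κ V x)
      = Real.log (stateAuxLaw pS κ (x.1, x.2.1)) + Real.log (V x.1 x.2.1 x.2.2) := by
    rw [← Real.log_mul h1.ne' h2.ne']
    rfl
  rw [Real.log_div h2.ne' h4.ne', h6]
  ring

include hκ1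

/-- The value is $I(S;U)$ and does not depend on the channel, which only places all entropies on one
sample space. -/
lemma sum_log_kernel_aux :
    ∑ x, stateAuxLaw pS κ x * Real.log (κ x.1 x.2 / auxLaw pS κ x.2)
      = natEntropy (jointLaw pS κ V) (fun x => x.1)
        + natEntropy (jointLaw pS κ V) (fun x => x.2.1)
        - natEntropy (jointLaw pS κ V) (fun x => (x.1, x.2.1)) := by
  rw [← law_jointLaw_stateAux hV1,
    sum_law_mul (jointLaw pS κ V) (fun x => (x.1, x.2.1))
      (fun x => Real.log (κ x.1 x.2 / auxLaw pS κ x.2))]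
  simp only [natEntropy, law_jointLaw_stateAux hV1, law_jointLaw_aux hV1,
    law_jointLaw_state hκ1 hV1, ← Finset.sum_sub_distrib, ← Finset.sum_add_distrib]
  refine Finset.sum_congr rfl fun x _ => ?_
  rcases (jointLaw_nonneg hpS hκ hV x).eq_or_lt with h | h
  · simp [← h]
  obtain ⟨h1, h2, h3, h4, h5⟩ := pos_of_jointLaw_pos hpS hκ hV h
  have h7 := (pos_of_stateAuxLaw_pos hpS hκ h1).1
  have h8 : 0 < pS x.1 := (hpS _).lt_of_ne fun h0 => h1.ne (by simp [stateAuxLaw, ← h0])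
  have h6 : Real.log (stateAuxLaw pS κ (x.1, x.2.1))
      = Real.log (pS x.1) + Real.log (κ x.1 x.2.1) := by
    rw [← Real.log_mul h8.ne' h7.ne']
    rfl
  dsimp only at h7 ⊢
  rw [Real.log_div h7.ne' h3.ne', h6]
  ring

end SingleLetter

/-! ### From codewords to a stochastic encoder -/

section Encoder

variable {S U X Y Z : Type*} [Fintype S] [Fintype U] [Fintype X] [Fintype Y] [Fintype Z]

lemma natEntropy_codeLaw_state {n : ℕ} {L : Type*} [Fintype L] [Nonempty L] {pS : S → ℝ}
    (hpS1 : ∑ s, pS s = 1) {𝒰 : Type*} {w : (Fin n → S) → L → 𝒰}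
    {V : (Fin n → S) → 𝒰 → Y → ℝ} (hV1 : ∀ s u, ∑ y, V s u y = 1) :
    natEntropy (codeLaw (fun s => ∏ i, pS (s i)) w V) (fun x => x.1)
      = n * natEntropy pS (fun s => s) := by
  rw [← natEntropy_law (codeLaw (fun s => ∏ i, pS (s i)) w V) (fun x => x.1) (fun s => s),
    funext (law_codeLaw_state hV1)]
  simp only [natEntropy, law_self]
  have h1 : ∀ s : Fin n → S, (∏ i, pS (s i)) * -Real.log (∏ i, pS (s i))
      = (∏ i, pS (s i)) * ∑ i, -Real.log (pS (s i)) := by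
    intro s
    by_cases h : ∏ i, pS (s i) = 0
    · simp [h]
    · rw [Real.log_prod fun i _ => (Finset.prod_ne_zero_iff.1 h) i (mem_univ i),
        Finset.sum_neg_distrib]
  calc _ = iidExp pS (fun s : Fin n → S => ∑ i, -Real.log (pS (s i))) :=
        Finset.sum_congr rfl fun s _ => h1 s
    _ = ∑ _i : Fin n, ∑ x, pS x * -Real.log (pS x) := by
        rw [iidExp_sum]
        exact Finset.sum_congr rfl fun i _ => iidExp_apply hpS1 (fun x => -Real.log (pS x)) i
    _ = _ := by simp

/-- The encoder which draws `l` uniformly and sends the codeword `w s l` through the prefix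
channel `r`. -/
noncomputable def codeEncoder {n : ℕ} {L : Type*} [Fintype L] (r : S → U → X → ℝ)
    (w : (Fin n → S) → L → (Fin n → U)) : (Fin n → S) → (Fin n → X) → ℝ :=
  fun s x => ∑ l, (Fintype.card L : ℝ)⁻¹ * ∏ i, r (s i) (w s l i) (x i)

lemma isEncoder_codeEncoder {n : ℕ} {L : Type*} [Fintype L] [Nonempty L] {r : S → U → X → ℝ}
    (hr : ∀ s u x, 0 ≤ r s u x) (hr1 : ∀ s u, ∑ x, r s u x = 1)
    (w : (Fin n → S) → L → (Fin n → U)) : IsEncoder (codeEncoder r w) := by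
  intro s
  refine ⟨fun x => Finset.sum_nonneg fun l _ =>
    mul_nonneg (by positivity) (Finset.prod_nonneg fun i _ => hr _ _ _), ?_⟩
  simp only [codeEncoder]
  rw [Finset.sum_comm]
  simp only [← Finset.mul_sum]
  rw [Finset.sum_congr rfl fun l _ => by rw [sum_prod_kernel fun i => hr1 (s i) (w s l i)]]
  simp

lemma sum_codeEncoder_mul {n : ℕ} {L : Type*} [Fintype L] {r : S → U → X → ℝ}
    (w : (Fin n → S) → L → (Fin n → U)) (s : Fin n → S) (f : Fin n → X → ℝ) :
    ∑ x, codeEncoder r w s x * ∏ i, f i (x i)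
      = ∑ l, (Fintype.card L : ℝ)⁻¹ * ∏ i, ∑ x, r (s i) (w s l i) x * f i x := by
  simp only [codeEncoder, Finset.sum_mul]
  rw [Finset.sum_comm]
  refine Finset.sum_congr rfl fun l _ => ?_
  simp only [mul_assoc, ← Finset.mul_sum, ← Finset.prod_mul_distrib]
  rw [sum_prod_eq_prod_sum (fun i x => r (s i) (w s l i) x * f i x)]

/-- The law of the state and the output of a code. -/
lemma law_codeLaw_state_out {𝒮 𝒰 𝒴 L : Type*} [Fintype 𝒮] [Fintype 𝒴] [Fintype L] {p : 𝒮 → ℝ}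
    {w : 𝒮 → L → 𝒰} {V : 𝒮 → 𝒰 → 𝒴 → ℝ} (s : 𝒮) (y : 𝒴) :
    law (codeLaw p w V) (fun x => (x.1, x.2.2)) (s, y)
      = p s * ∑ l, (Fintype.card L : ℝ)⁻¹ * V s (w s l) y := by
  classical
  rw [law_eq_sum]
  simp [Fintype.sum_prod_type, codeLaw, ite_and, Finset.sum_ite_irrel, Finset.mul_sum, mul_assoc]

/-- Averaging over inputs and over the unobserved output factors letter by letter, so the encoder
with its prefix channel acts as the code `w` over an effective memoryless channel from $(s,u)$ to
$y$. -/
lemma law_blockLaw_bob {n : ℕ} {L : Type*} [Fintype L] (pS : S → ℝ) (W : S → X → Y × Z → ℝ)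
    (r : S → U → X → ℝ) (w : (Fin n → S) → L → (Fin n → U)) :
    law (blockLaw pS W (codeEncoder r w)) (fun x => (x.1, x.2.2.1))
      = law (codeLaw (fun s => ∏ i, pS (s i)) w (fun s u (y : Fin n → Y) =>
          ∏ i, ∑ x, r (s i) (u i) x * ∑ z, W (s i) x (y i, z))) (fun x => (x.1, x.2.2)) := by
  classical
  ext ⟨s, y⟩
  rw [law_codeLaw_state_out, ← sum_codeEncoder_mul w s (fun i x => ∑ z, W (s i) x (y i, z)),
    law_eq_sum]
  simp only [Fintype.sum_prod_type, blockLaw, Prod.mk.injEq, ite_and, mul_ite, mul_one, mul_zero]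
  simp only [Finset.sum_ite_irrel, Finset.sum_const_zero, Finset.sum_ite_eq', mem_univ, if_true]
  simp only [mul_assoc, ← Finset.mul_sum]
  congr 1
  refine Finset.sum_congr rfl fun x _ => ?_
  congr 1
  exact sum_prod_eq_prod_sum (fun i z => W (s i) (x i) (y i, z))

lemma law_blockLaw_eve {n : ℕ} {L : Type*} [Fintype L] (pS : S → ℝ) (W : S → X → Y × Z → ℝ)
    (r : S → U → X → ℝ) (w : (Fin n → S) → L → (Fin n → U)) :
    law (blockLaw pS W (codeEncoder r w)) (fun x => (x.1, x.2.2.2))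
      = law (codeLaw (fun s => ∏ i, pS (s i)) w (fun s u (z : Fin n → Z) =>
          ∏ i, ∑ x, r (s i) (u i) x * ∑ y, W (s i) x (y, z i))) (fun x => (x.1, x.2.2)) := by
  classical
  ext ⟨s, z⟩
  rw [law_codeLaw_state_out, ← sum_codeEncoder_mul w s (fun i x => ∑ y, W (s i) x (y, z i)),
    law_eq_sum]
  simp only [Fintype.sum_prod_type, blockLaw, Prod.mk.injEq, ite_and, mul_ite, mul_one, mul_zero]
  simp only [Finset.sum_ite_irrel, Finset.sum_const_zero, Finset.sum_ite_eq', mem_univ, if_true]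
  simp only [mul_assoc, ← Finset.mul_sum]
  congr 1
  refine Finset.sum_congr rfl fun x _ => ?_
  congr 1
  exact sum_prod_eq_prod_sum (fun i y => W (s i) (x i) (y, z i))

lemma law_singleLaw_bob {pS : S → ℝ} {W : S → X → Y × Z → ℝ} {q : S → U × X → ℝ} {κ : S → U → ℝ}
    {r : S → U → X → ℝ} (hqr : ∀ s u x, κ s u * r s u x = q s (u, x)) :
    law (singleLaw pS W q) (fun x => (x.1, x.2.1, x.2.2.2.1))
      = jointLaw pS κ (fun s u y => ∑ x, r s u x * ∑ z, W s x (y, z)) := by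
  classical
  ext ⟨s, u, y⟩
  rw [law_eq_sum]
  simp only [Fintype.sum_prod_type, singleLaw, Prod.mk.injEq, ite_and, mul_ite, mul_one, mul_zero]
  simp only [Finset.sum_ite_irrel, Finset.sum_const_zero, Finset.sum_ite_eq', mem_univ, if_true,
    jointLaw, Finset.mul_sum, ← hqr]
  exact Finset.sum_congr rfl fun x _ => Finset.sum_congr rfl fun z _ => by ring

lemma law_singleLaw_eve {pS : S → ℝ} {W : S → X → Y × Z → ℝ} {q : S → U × X → ℝ} {κ : S → U → ℝ}
    {r : S → U → X → ℝ} (hqr : ∀ s u x, κ s u * r s u x = q s (u, x)) :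
    law (singleLaw pS W q) (fun x => (x.1, x.2.1, x.2.2.2.2))
      = jointLaw pS κ (fun s u z => ∑ x, r s u x * ∑ y, W s x (y, z)) := by
  classical
  ext ⟨s, u, z⟩
  rw [law_eq_sum]
  simp only [Fintype.sum_prod_type, singleLaw, Prod.mk.injEq, ite_and, mul_ite, mul_one, mul_zero]
  simp only [Finset.sum_ite_irrel, Finset.sum_const_zero, Finset.sum_ite_eq', mem_univ, if_true,
    jointLaw, Finset.mul_sum, ← hqr]
  exact Finset.sum_congr rfl fun x _ => Finset.sum_congr rfl fun z _ => by ring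

/-- Disintegration of a conditional law on a product. -/
lemma exists_disintegration [Nonempty X] {q : S → U × X → ℝ}
    (hq : ∀ s, q s ∈ stdSimplex ℝ (U × X)) :
    ∃ (κ : S → U → ℝ) (r : S → U → X → ℝ), (∀ s u, 0 ≤ κ s u) ∧ (∀ s, ∑ u, κ s u = 1) ∧
      (∀ s u x, 0 ≤ r s u x) ∧ (∀ s u, ∑ x, r s u x = 1) ∧
      ∀ s u x, κ s u * r s u x = q s (u, x) := by
  classical
  have hX : (0 : ℝ) < Fintype.card X := by exact_mod_cast Fintype.card_pos
  have hκ0 : ∀ s u, 0 ≤ ∑ x, q s (u, x) := fun s u => Finset.sum_nonneg fun x _ => (hq s).1 _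
  -- Where $u$ has conditional probability zero, the prefix law is set to uniform so that it remains
  -- a probability law.
  refine ⟨fun s u => ∑ x, q s (u, x), fun s u x => if ∑ x, q s (u, x) = 0 then
    (Fintype.card X : ℝ)⁻¹ else q s (u, x) / ∑ x, q s (u, x), hκ0, fun s => ?_,
    fun s u x => ?_, fun s u => ?_, fun s u x => ?_⟩
  · rw [← (hq s).2, Fintype.sum_prod_type]
  · beta_reduce
    split_ifs
    · positivity
    · exact div_nonneg ((hq s).1 _) (hκ0 s u)
  · beta_reduce
    split_ifs with h
    · simp
    · rw [← Finset.sum_div, div_self h]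
  · beta_reduce
    split_ifs with h
    · rw [h, zero_mul]
      exact ((Finset.sum_eq_zero_iff_of_nonneg fun x _ => (hq s).1 _).1 h x (mem_univ x)).symm
    · rw [mul_div_cancel₀ _ h]

end Encoder

/-! ### The choice of rates and the conclusion -/

section Achievability

variable {S X Y Z : Type*} [Fintype S] [Fintype X] [Fintype Y] [Fintype Z]

/-- An achievable pair within $\varepsilon/2$, used with tolerance $\varepsilon/2$, provides the
encoders. Closedness reduces the theorem to the individual pairs of the union. -/
lemma isClosed_achievableRegion (pS : S → ℝ) (W : S → X → Y × Z → ℝ) :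
    IsClosed (achievableRegion pS W) := by
  refine isClosed_of_closure_subset fun R hR ε hε => ?_
  obtain ⟨R', hR', hd⟩ := Metric.mem_closure_iff.1 hR (ε / 2) (by positivity)
  obtain ⟨N, hN⟩ := hR' (ε / 2) (by positivity)
  refine ⟨N, fun n hn => ?_⟩
  obtain ⟨enc, henc, h1, h2⟩ := hN n hn
  have h3 : |R.1 - R'.1| < ε / 2 :=
    (le_max_left _ _).trans_lt ((Prod.dist_eq (x := R) (y := R')) ▸ hd)
  have h4 : |R.2 - R'.2| < ε / 2 :=
    (le_max_right _ _).trans_lt ((Prod.dist_eq (x := R) (y := R')) ▸ hd)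
  rw [abs_lt] at h3 h4
  exact ⟨enc, henc, by linarith, by linarith⟩

/-- The rates of the random code, in nats. -/
lemma eventually_exists_encoder {U : Type*} [Fintype U] {pS : S → ℝ} (hpS : pS ∈ stdSimplex ℝ S)
    {W : S → X → Y × Z → ℝ} (hW : ∀ s x, W s x ∈ stdSimplex ℝ (Y × Z))
    {q : S → U × X → ℝ} (hq : ∀ s, q s ∈ stdSimplex ℝ (U × X))
    {hS hU hY hZ hSU hUY hUZ hSUY hSUZ ρ : ℝ}
    (eS : hS = natEntropy (singleLaw pS W q) (fun x => x.1))
    (eU : hU = natEntropy (singleLaw pS W q) (fun x => x.2.1))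
    (eY : hY = natEntropy (singleLaw pS W q) (fun x => x.2.2.2.1))
    (eZ : hZ = natEntropy (singleLaw pS W q) (fun x => x.2.2.2.2))
    (eSU : hSU = natEntropy (singleLaw pS W q) (fun x => (x.1, x.2.1)))
    (eUY : hUY = natEntropy (singleLaw pS W q) (fun x => (x.2.1, x.2.2.2.1)))
    (eUZ : hUZ = natEntropy (singleLaw pS W q) (fun x => (x.2.1, x.2.2.2.2)))
    (eSUY : hSUY = natEntropy (singleLaw pS W q) (fun x => (x.1, x.2.1, x.2.2.2.1)))
    (eSUZ : hSUZ = natEntropy (singleLaw pS W q) (fun x => (x.1, x.2.1, x.2.2.2.2)))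
    (hρ₁ : ρ ≤ hU + hY - hUY - max (hU + hS - hSU) (hU + hZ - hUZ))
    (hρ₂ : ρ ≤ hSUY - hUY) {ε : ℝ} (hε : 0 < ε) :
    ∀ᶠ n : ℕ in atTop, ∃ enc : (Fin n → S) → (Fin n → X) → ℝ, IsEncoder enc ∧
      hS - (hSUY - hUY) + ρ - ε ≤ amplificationRate pS W enc * Real.log 2 ∧
      leakageRate pS W enc * Real.log 2
        ≤ min (hSU + hZ - hSUZ) (hS + hUZ - hSUZ) + ε := by
  -- A law of total mass one cannot live on an empty alphabet. This gives nonemptiness of all the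
  -- alphabets in turn.
  have : Nonempty S := by
    by_contra h
    have := not_nonempty_iff.1 h
    simpa using hpS.2
  have s₀ : S := Classical.arbitrary S
  have hUX : Nonempty (U × X) := by
    by_contra h
    have := not_nonempty_iff.1 h
    simpa using (hq s₀).2
  have : Nonempty X := hUX.map Prod.snd
  have hYZ : Nonempty (Y × Z) := by
    by_contra h
    have := not_nonempty_iff.1 h
    simpa using (hW s₀ (Classical.arbitrary X)).2
  have : Nonempty Y := hYZ.map Prod.fst
  have : Nonempty Z := hYZ.map Prod.snd
  obtain ⟨κ, r, hκ, hκ1, hr, hr1, hqr⟩ := exists_disintegration hq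
  set VY : S → U → Y → ℝ := fun s u y => ∑ x, r s u x * ∑ z, W s x (y, z) with hVYdef
  set VZ : S → U → Z → ℝ := fun s u z => ∑ x, r s u x * ∑ y, W s x (y, z) with hVZdef
  have hVY : ∀ s u y, 0 ≤ VY s u y := fun s u y => Finset.sum_nonneg fun x _ =>
    mul_nonneg (hr _ _ _) (Finset.sum_nonneg fun z _ => (hW s x).1 _)
  have hVZ : ∀ s u z, 0 ≤ VZ s u z := fun s u z => Finset.sum_nonneg fun x _ =>
    mul_nonneg (hr _ _ _) (Finset.sum_nonneg fun y _ => (hW s x).1 _)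
  have hVY1 : ∀ s u, ∑ y, VY s u y = 1 := fun s u => by
    simp only [hVYdef]
    rw [Finset.sum_comm, ← hr1 s u]
    refine Finset.sum_congr rfl fun x _ => ?_
    rw [← Finset.mul_sum, ← Fintype.sum_prod_type, (hW s x).2, mul_one]
  have hVZ1 : ∀ s u, ∑ z, VZ s u z = 1 := fun s u => by
    simp only [hVZdef]
    rw [Finset.sum_comm, ← hr1 s u]
    refine Finset.sum_congr rfl fun x _ => ?_
    rw [← Finset.mul_sum, ← Fintype.sum_prod_type_right, (hW s x).2, mul_one]
  have hpS0 : ∀ s, 0 ≤ pS s := hpS.1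
  have hpS1 : ∑ s, pS s = 1 := hpS.2
  have hJY : law (singleLaw pS W q) (fun x => (x.1, x.2.1, x.2.2.2.1)) = jointLaw pS κ VY :=
    law_singleLaw_bob hqr
  have hJZ : law (singleLaw pS W q) (fun x => (x.1, x.2.1, x.2.2.2.2)) = jointLaw pS κ VZ :=
    law_singleLaw_eve hqr
  set P := singleLaw pS W q with hP
  have hi : hS + hU - hSU
      = ∑ x, stateAuxLaw pS κ x * Real.log (κ x.1 x.2 / auxLaw pS κ x.2) := by
    rw [sum_log_kernel_aux hpS0 hκ hκ1 hVY hVY1]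
    simp only [← hJY, natEntropy_law, eS, eU, eSU]
  have ha₁ : hSUY - hU - hY = ∑ x, jointLaw pS κ VY x * Real.log
      (auxLaw pS κ x.2.1 * outLaw pS κ VY x.2.2 / jointLaw pS κ VY x) := by
    rw [sum_log_aux_out_joint hpS0 hκ hVY hVY1]
    simp only [← hJY, natEntropy_law, eY, eU, eSUY]
  have ha₂ : hSUY - hUY = ∑ x, jointLaw pS κ VY x * Real.log
      (auxOutLaw pS κ VY x.2.1 x.2.2 / jointLaw pS κ VY x) := by
    rw [sum_log_auxOut_joint hpS0 hκ hVY hVY1]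
    simp only [← hJY, natEntropy_law, eUY, eSUY]
  have hc₁ : hUZ - hU - hZ = ∑ x, jointLaw pS κ VZ x * Real.log
      (auxLaw pS κ x.2.1 * outLaw pS κ VZ x.2.2 / auxOutLaw pS κ VZ x.2.1 x.2.2) := by
    rw [sum_log_aux_out_auxOut hpS0 hκ hVZ hVZ1]
    simp only [← hJZ, natEntropy_law, eUZ, eU, eZ]
  have hc₂ : hSU + hZ - hSUZ = ∑ x, jointLaw pS κ VZ x * Real.log
      (VZ x.1 x.2.1 x.2.2 / outLaw pS κ VZ x.2.2) := by
    rw [sum_log_kernel_out hpS0 hκ hVZ hVZ1]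
    simp only [← hJZ, natEntropy_law, eSU, eZ, eSUZ]
  have hi0 : 0 ≤ hS + hU - hSU := by
    have := natEntropy_prod_le (jointLaw_nonneg hpS0 hκ hVY) (sum_jointLaw hpS1 hκ1 hVY1)
      (fun x => x.1) (fun x => x.2.1)
    simp only [← hJY, natEntropy_law, ← eS, ← eU, ← eSU] at this
    linarith
  have hc₂0 : 0 ≤ hSU + hZ - hSUZ := by
    have := natEntropy_prod_le (jointLaw_nonneg hpS0 hκ hVZ) (sum_jointLaw hpS1 hκ1 hVZ1)
      (fun x => (x.1, x.2.1)) (fun x => x.2.2)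
    have h2 := natEntropy_comp_equiv (jointLaw pS κ VZ) (fun x => ((x.1, x.2.1), x.2.2))
      (Equiv.prodAssoc S U Z)
    simp only [← hJZ, natEntropy_law, ← eSU, ← eZ] at this h2
    simp only [Equiv.prodAssoc_apply, ← eSUZ] at h2
    linarith
  have eSp : natEntropy pS (fun s => s) = hS := by
    have h1 := natEntropy_law (jointLaw pS κ VY) (fun x => x.1) (fun s => s)
    rw [law_jointLaw_state hκ1 hVY1] at h1
    rw [h1, ← hJY, natEntropy_law, eS]
  -- The least rate of local randomness that fills the codebook up to exponent
  -- $\max\{I(U;S),I(U;Z)\}$: a larger rate would hurt Bob, a smaller one would give up secrecy.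
  set R := max (hU + hS - hSU) (hU + hZ - hUZ) - (hU + hS - hSU) with hR
  have hR0 : 0 ≤ R := sub_nonneg.2 (le_max_left _ _)
  have hmaxZ : hU + hZ - hUZ ≤ R + (hU + hS - hSU) := by
    rw [hR, sub_add_cancel]; exact le_max_right _ _
  set lS := Real.log (Fintype.card S) with hlS
  set lZ := Real.log (Fintype.card Z) with hlZ
  have hlS0 : 0 ≤ lS := Real.log_nonneg (by exact_mod_cast Fintype.card_pos)
  have hlZ0 : 0 ≤ lZ := Real.log_nonneg (by exact_mod_cast Fintype.card_pos)
  have hl2 : 0 < Real.log 2 := Real.log_pos (by norm_num)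
  -- The budget is split in thirds: at most $8\delta=\varepsilon/3$ for typicality slack,
  -- $2\eta(\ldots)\le\varepsilon/3$ for errors, and $\varepsilon/3$ for the constants divided by
  -- $n$.
  set δ := ε / 24 with hδ
  set η := ε / (6 * (lS + lZ + R + 1)) with hη
  have hδ0 : 0 < δ := by positivity
  have hη0 : 0 < η := by positivity
  have hηle : 2 * η * (lS + lZ + R) ≤ ε / 3 := by
    have h1 : η * (6 * (lS + lZ + R + 1)) = ε := div_mul_cancel₀ _ (by positivity)
    linarith
  -- The constants collected from the leakage and index bounds. The last summand comes from
  -- $2\eta\log l$ with $\log l\le\log 2+nR$.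
  set D := 2 * Real.log 2 + 2 + 2 * η * Real.log 2 with hD
  have hD0 : 0 < D := by positivity
  have hDlim : Tendsto (fun n : ℕ => D / n) atTop (𝓝 0) :=
    tendsto_natCast_atTop_atTop.const_div_atTop D
  -- The hash rate is $\max(\rho,0)$ since $\rho$ may be negative. The hypothesis $\rho\le H(S|Y,U)$
  -- makes Bob's list exponent `B` nonnegative, and $I(U;Z)\le R+I(U;S)$ does the same for Eve's
  -- exponent `C`.
  filter_upwards [eventually_gt_atTop 0, hDlim.eventually_le_const (by positivity : 0 < ε / 3),
    eventually_exists_block_code hpS0 hpS1 hκ hκ1 hVY hVY1 hVZ hVZ1 hi ha₁ ha₂ hc₁ hc₂ hi0 hc₂0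
      (Rm := max ρ 0) (B := hSUY - hUY - ρ + 7 * δ)
      (C := hS + hU - hSU + R + (hUZ - hU - hZ) + 7 * δ) hδ0 hη0 hR0
      (le_max_right _ _) (by linarith) (by linarith) (by linarith)
      (by linarith [le_max_left ρ 0]) le_rfl] with n hn0 hDn hcode
  obtain ⟨l, hl0, hlR, hlR', w, hBob, hEve, hIdx⟩ := hcode
  have hn : (0 : ℝ) < n := by exact_mod_cast hn0
  have : Nonempty (Fin l) := ⟨⟨0, hl0⟩⟩
  rw [div_le_iff₀ hn] at hDn
  have hlogl₁ : n * R ≤ Real.log l := by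
    rw [Real.le_log_iff_exp_le (by exact_mod_cast hl0)]
    exact hlR
  have hlogl₂ : Real.log l ≤ Real.log 2 + n * R := by
    rw [← Real.log_exp (n * R), ← Real.log_mul (by norm_num) (Real.exp_pos _).ne']
    exact Real.log_le_log (by exact_mod_cast hl0) hlR'
  have hp0 : ∀ s : Fin n → S, 0 ≤ ∏ i, pS (s i) := fun s => Finset.prod_nonneg fun i _ => hpS0 _
  have hp1 : ∑ s : Fin n → S, ∏ i, pS (s i) = 1 := sum_prod_kernel fun _ => hpS1
  have hVZn : ∀ (s : Fin n → S) (u : Fin n → U) (z : Fin n → Z), 0 ≤ ∏ i, VZ (s i) (u i) (z i) :=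
    fun s u z => Finset.prod_nonneg fun i _ => hVZ _ _ _
  have hVYn1 : ∀ (s : Fin n → S) (u : Fin n → U), ∑ y : Fin n → Y, ∏ i, VY (s i) (u i) (y i) = 1 :=
    fun s u => sum_prod_kernel fun _ => hVY1 _ _
  have hVZn1 : ∀ (s : Fin n → S) (u : Fin n → U), ∑ z : Fin n → Z, ∏ i, VZ (s i) (u i) (z i) = 1 :=
    fun s u => sum_prod_kernel fun _ => hVZ1 _ _
  refine ⟨codeEncoder r w, isEncoder_codeEncoder hr hr1 w, ?_, ?_⟩
  · have h1 : amplificationRate pS W (codeEncoder r w)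
        = mutualInfo (codeLaw (fun s => ∏ i, pS (s i)) w (fun s u (y : Fin n → Y) =>
            ∏ i, VY (s i) (u i) (y i))) (fun x => x.1) (fun x => x.2.2) / n :=
      congrArg (· / (n : ℝ)) (mutualInfo_eq_of_law_eq (law_blockLaw_bob pS W r w))
    have h2 := natEntropy_codeLaw_state (L := Fin l) hpS1 (w := w)
      (V := fun s u (y : Fin n → Y) => ∏ i, VY (s i) (u i) (y i)) hVYn1
    rw [eSp] at h2
    have h3 : amplificationRate pS W (codeEncoder r w) * Real.log 2 * n
        = natEntropy (codeLaw (fun s => ∏ i, pS (s i)) w (fun s u (y : Fin n → Y) =>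
            ∏ i, VY (s i) (u i) (y i))) (fun x => x.1)
          + natEntropy (codeLaw (fun s => ∏ i, pS (s i)) w (fun s u (y : Fin n → Y) =>
            ∏ i, VY (s i) (u i) (y i))) (fun x => x.2.2)
          - natEntropy (codeLaw (fun s => ∏ i, pS (s i)) w (fun s u (y : Fin n → Y) =>
            ∏ i, VY (s i) (u i) (y i))) (fun x => (x.1, x.2.2)) := by
      rw [h1, mutualInfo_eq]
      field_simp
    refine le_of_mul_le_mul_right ?_ hn
    rw [h3, h2]
    have h4 : 2 * η * lS ≤ 2 * η * (lS + lZ + R) := by gcongr; linarith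
    have h5 : 0 ≤ 2 * η * Real.log 2 := by positivity
    have h6 : n * (2 * η * lS + 7 * δ) ≤ n * (ε / 3 + ε / 3) := by
      refine mul_le_mul_of_nonneg_left ?_ hn.le
      linarith
    linarith
  · have h1 : leakageRate pS W (codeEncoder r w)
        = mutualInfo (codeLaw (fun s => ∏ i, pS (s i)) w (fun s u (z : Fin n → Z) =>
            ∏ i, VZ (s i) (u i) (z i))) (fun x => x.1) (fun x => x.2.2) / n :=
      congrArg (· / (n : ℝ)) (mutualInfo_eq_of_law_eq (law_blockLaw_eve pS W r w))
    have h3 : leakageRate pS W (codeEncoder r w) * Real.log 2 * n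
        = natEntropy (codeLaw (fun s => ∏ i, pS (s i)) w (fun s u (z : Fin n → Z) =>
            ∏ i, VZ (s i) (u i) (z i))) (fun x => x.1)
          + natEntropy (codeLaw (fun s => ∏ i, pS (s i)) w (fun s u (z : Fin n → Z) =>
            ∏ i, VZ (s i) (u i) (z i))) (fun x => x.2.2)
          - natEntropy (codeLaw (fun s => ∏ i, pS (s i)) w (fun s u (z : Fin n → Z) =>
            ∏ i, VZ (s i) (u i) (z i))) (fun x => (x.1, x.2.2)) := by
      rw [h1, mutualInfo_eq]
      field_simp
    have hIdx' := natCondEntropy_le_log_card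
      (codeLaw_nonneg (L := Fin l) (w := w) hp0 hVZn) (sum_codeLaw hp1 hVZn1)
      (fun x => x.2.1) (fun x => (x.1, x.2.2))
    rw [Fintype.card_fin] at hIdx'
    refine le_of_mul_le_mul_right ?_ hn
    rw [h3]
    have h5 : 0 ≤ 2 * η * Real.log 2 := by positivity
    -- Since $I(U,S;Z)-I(S;Z,U)=I(U;Z)-I(U;S)$, the case decides the minimum. In the first case
    -- Eve's list exponent is only $7\delta$ and $-\log l$ gains $nR$. In the second, the trivial
    -- bound on her index uncertainty cancels $-\log l$.
    rcases le_total (hU + hS - hSU) (hU + hZ - hUZ) with hle | hle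
    · have hReq : R = (hU + hZ - hUZ) - (hU + hS - hSU) := by rw [hR, max_eq_right hle]
      rw [min_eq_right (by linarith)]
      have h6 : n * (2 * η * (lS + lZ + R) + 8 * δ) ≤ n * (ε / 3 + ε / 3) := by
        refine mul_le_mul_of_nonneg_left ?_ hn.le
        linarith
      have h7 : 0 ≤ n * (2 * η * lS) := by positivity
      have h8 : 2 * η * Real.log l ≤ 2 * η * (Real.log 2 + n * R) := by gcongr
      have h9 : n * (hS + hU - hSU + R + (hUZ - hU - hZ) + 7 * δ) = n * (7 * δ) := by
        rw [hReq]; ring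
      have h10 : n * R = n * ((hU + hZ - hUZ) - (hU + hS - hSU)) := by rw [hReq]
      rw [h9] at hIdx
      linarith
    · rw [min_eq_left (by linarith)]
      have h6 : n * (2 * η * lZ + δ) ≤ n * (ε / 3 + ε / 3) := by
        refine mul_le_mul_of_nonneg_left ?_ hn.le
        have h4 : 2 * η * lZ ≤ 2 * η * (lS + lZ + R) := by gcongr; linarith
        linarith
      linarith

/-- Only a change of units and of the order of tuples: multiplying by $\log 2$ turns the three
constraints into those of `eventually_exists_encoder` with $\rho=R_u\log 2$ and tolerance
$\varepsilon\log 2$. -/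
lemma refinementPairs_subset_achievableRegion {U : Type*} [Fintype U] {pS : S → ℝ}
    (hpS : pS ∈ stdSimplex ℝ S) {W : S → X → Y × Z → ℝ}
    (hW : ∀ s x, W s x ∈ stdSimplex ℝ (Y × Z)) {q : S → U × X → ℝ}
    (hq : ∀ s, q s ∈ stdSimplex ℝ (U × X)) :
    refinementPairs pS W q ⊆ achievableRegion pS W := by
  rintro R ⟨Ru, h1, h2, h3⟩ ε hε
  have hl2 : 0 < Real.log 2 := Real.log_pos (by norm_num)
  set P := singleLaw pS W q with hP
  have eYU : natEntropy P (fun x => (x.2.2.2.1, x.2.1)) = natEntropy P (fun x => (x.2.1, x.2.2.2.1)) :=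
    natEntropy_comp_equiv P (fun x => (x.2.1, x.2.2.2.1)) (Equiv.prodComm _ _)
  have eZU : natEntropy P (fun x => (x.2.2.2.2, x.2.1)) = natEntropy P (fun x => (x.2.1, x.2.2.2.2)) :=
    natEntropy_comp_equiv P (fun x => (x.2.1, x.2.2.2.2)) (Equiv.prodComm _ _)
  have eUS : natEntropy P (fun x => (x.2.1, x.1)) = natEntropy P (fun x => (x.1, x.2.1)) :=
    natEntropy_comp_equiv P (fun x => (x.1, x.2.1)) (Equiv.prodComm _ _)
  have eSYU : natEntropy P (fun x => (x.1, x.2.2.2.1, x.2.1))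
      = natEntropy P (fun x => (x.1, x.2.1, x.2.2.2.1)) :=
    natEntropy_comp_equiv P (fun x => (x.1, x.2.1, x.2.2.2.1))
      ((Equiv.refl _).prodCongr (Equiv.prodComm _ _))
  have eSZU : natEntropy P (fun x => (x.1, x.2.2.2.2, x.2.1))
      = natEntropy P (fun x => (x.1, x.2.1, x.2.2.2.2)) :=
    natEntropy_comp_equiv P (fun x => (x.1, x.2.1, x.2.2.2.2))
      ((Equiv.refl _).prodCongr (Equiv.prodComm _ _))
  have eUSZ : natEntropy P (fun x => ((x.2.1, x.1), x.2.2.2.2))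
      = natEntropy P (fun x => (x.1, x.2.1, x.2.2.2.2)) :=
    natEntropy_comp_equiv P (fun x => (x.1, x.2.1, x.2.2.2.2))
      ((Equiv.prodAssoc _ _ _).symm.trans ((Equiv.prodComm _ _).prodCongr (Equiv.refl _)))
  simp only [mutualInfo_eq, condEntropy, entropy_eq, eYU, eZU, eUS, eSYU, eSZU, eUSZ] at h1 h2 h3
  rw [min_div_div_right hl2.le, div_le_iff₀ hl2] at h2
  rw [le_min_iff, max_div_div_right hl2.le, ← sub_div, ← sub_div, le_div_iff₀ hl2,
    le_div_iff₀ hl2] at h3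
  rw [← sub_le_iff_le_add, le_div_iff₀ hl2] at h1
  obtain ⟨N, hN⟩ := eventually_atTop.1 (eventually_exists_encoder hpS hW hq rfl rfl rfl rfl rfl rfl
    rfl rfl rfl h3.1 h3.2 (mul_pos hε hl2))
  refine ⟨N, fun n hn => ?_⟩
  obtain ⟨enc, henc, hB, hE⟩ := hN n hn
  exact ⟨enc, henc, le_of_mul_le_mul_right (by linarith) hl2,
    le_of_mul_le_mul_right (by linarith) hl2⟩

end Achievability

end StateMasking

theorem mainTheorem4 {S X Y Z : Type*} [Fintype S] [Fintype X] [Fintype Y] [Fintype Z]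
    (pS : S → ℝ) (hpS : pS ∈ stdSimplex ℝ S)
    (W : S → X → Y × Z → ℝ) (hW : ∀ s x, W s x ∈ stdSimplex ℝ (Y × Z)) :
    StateMasking.secureRefinementRegion pS W ⊆ StateMasking.achievableRegion pS W := by
  refine closure_minimal ?_ (StateMasking.isClosed_achievableRegion pS W)
  rintro R ⟨k, q, hq, -, hR⟩
  exact StateMasking.refinementPairs_subset_achievableRegion hpS hW hq hR
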